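/- **Definitions.** A permutation $\pi$ of $\{1,\dots,m\}$ is *layered* if, written as a word, it is a strictly increasing sequence of (nonempty, consecutive) strictly decreasing substrings, called its *layers*: the entries decrease inside a layer, and every entry of a layer is smaller than every entry of any later layer. For a set $S$ of permutations of length $m$ let $\delta(S,k,n)$ be the maximum over words $\sigma\in\{1,\dots,k\}^n$ of the number of length-$m$ subsequences of $\sigma$ that are order-isomorphic to an element of $S$, divided by $\binom nm$. The *packing density* $\delta(S)$ is the common value of $\lim_{n\to\infty}\lim_{k\to\infty}\delta(S,k,n)$ and $\lim_{k\to\infty}\lim_{n\to\infty}\delta(S,k,n)$. Let $S$ be a nonempty set of layered permutations of length $m$, each with exactly $r\ge 1$ layers, and let $m_i^\pi$ be the length of the $i$-th layer of $\pi\in S$. A *partition of unity* is a finite or infinite sequence $\lambda=(\lambda_i)_{i\ge1}$ of non-negative reals with sum $1$; its *parts* are its nonzero terms. Put $$F_S(\lambda)=\sum_{\pi\in S}\binom{m}{m_1^\pi,\dots,m_r^\pi}\sum_{i_1<\dots<i_r}\lambda_{i_1}^{m_1^\pi}\cdots\lambda_{i_r}^{m_r^\pi}.$$ A partition of unity is *optimal*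 for $S$ if it maximizes $F_S$ among all partitions of unity. The set $S$ is *simple* if some optimal partition of unity has exactly $r$ parts. **Proposition.** Suppose that $S$ has an optimal partition of unity whose parts, in their order, are increasing (in the weak sense). Let $m^-$ be the length of the shortest layer of any permutation in $S$. If $\log_2(r+1)\le m^-$, then $S$ is simple, the packing density $\delta(S)$ exists (that is, both iterated limits exist and agree), and $$\delta(S)=\sup\Big\{\sum_{\pi\in S}\binom{m}{m_1^\pi,\dots,m_r^\pi}\prod_{i=1}^r\lambda_i^{m_i^\pi}\ :\ \lambda_1,\dots,\lambda_r\ge0,\ \sum_{i=1}^r\lambda_i=1\Big\}.$$ -/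

import Mathlib

open Filter Topology

noncomputable section

/-! ### Occurrences and packing density of sets of patterns in words -/

/-- The word `σ` read at the positions `f` is order-isomorphic to the pattern `p`. -/
def IsOccurrence {l m k n : ℕ} (p : Fin m → Fin l) (σ : Fin n → Fin k) (f : Fin m ↪o Fin n) :
    Prop :=
  ∀ i j, p i < p j ↔ σ (f i) < σ (f j)

/-- `ν(P, σ)`: the number of subsequences of `σ` that are an occurrence of a pattern in `P`. -/
def numOccurrences {l m k n : ℕ} (P : Set (Fin m → Fin l)) (σ : Fin n → Fin k) : ℕ :=
  Set.ncard {f : Fin m ↪o Fin n | ∃ p ∈ P, IsOccurrence p σ f}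

/-- `μ(P, k, n)`: the largest number of occurrences in a word of length `n` over `k` letters. -/
def maxOccurrences {l m : ℕ} (P : Set (Fin m → Fin l)) (k n : ℕ) : ℕ :=
  Finset.univ.sup fun σ : Fin n → Fin k => numOccurrences P σ

/-- `δ(P, k, n)`: the largest proportion of subsequences of length `m` that are occurrences. -/
def maxDensity {l m : ℕ} (P : Set (Fin m → Fin l)) (k n : ℕ) : ℝ :=
  (maxOccurrences P k n : ℝ) / (n.choose m : ℝ)

/-- The packing density of `P` is `d`: both iterated limits of `δ(P, k, n)` exist
and their common value is `d`. -/
def HasPackingDensity {l m : ℕ} (P : Set (Fin m → Fin l)) (d : ℝ) : Prop :=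
  (∃ a : ℕ → ℝ, (∀ n, Tendsto (fun k => maxDensity P k n) atTop (𝓝 (a n))) ∧
      Tendsto a atTop (𝓝 d)) ∧
    ∃ b : ℕ → ℝ, (∀ k, Tendsto (fun n => maxDensity P k n) atTop (𝓝 (b k))) ∧
      Tendsto b atTop (𝓝 d)

/-- The patterns given by a set of permutations, as words. -/
def patternsOf {m : ℕ} (S : Finset (Equiv.Perm (Fin m))) : Set (Fin m → Fin m) :=
  {p | ∃ π ∈ S, p = ⇑π}

/-! ### Layered permutations -/

/-- `π` is layered with exactly `r` layers, of lengths `a 0, …, a (r - 1)` in this order.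
The map `b` sends a position to the index of its layer: layers are nonempty intervals of
positions, `π` is decreasing inside a layer and increasing from one layer to a later one. -/
def HasLayers {m r : ℕ} (π : Equiv.Perm (Fin m)) (a : Fin r → ℕ) : Prop :=
  ∃ b : Fin m → Fin r, Monotone b ∧ Function.Surjective b ∧
    (∀ p q, p < q → (π q < π p ↔ b p = b q)) ∧
    ∀ i, a i = (Finset.univ.filter fun p => b p = i).card

/-! ### Partitions of unity -/

/-- A (possibly infinite) partition of unity; its parts are its nonzero terms. -/
def IsPartitionOfUnity (lam : ℕ → ℝ) : Prop :=
  (∀ i, 0 ≤ lam i) ∧ HasSum lam 1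

/-- `∑_{π ∈ S} (m; a₁^π, …, a_r^π) ∑_{i₁ < ⋯ < i_r} λ_{i₁}^{a₁^π} ⋯ λ_{i_r}^{a_r^π}`. -/
def partitionDensity {m r : ℕ} (S : Finset (Equiv.Perm (Fin m)))
    (a : Equiv.Perm (Fin m) → Fin r → ℕ) (lam : ℕ → ℝ) : ℝ :=
  ∑ π ∈ S, (Nat.multinomial Finset.univ (a π) : ℝ) *
    ∑' f : Fin r ↪o ℕ, ∏ j, lam (f j) ^ a π j

/-- `lam` maximizes `partitionDensity` among all partitions of unity. -/
def IsOptimalPartition {m r : ℕ} (S : Finset (Equiv.Perm (Fin m)))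
    (a : Equiv.Perm (Fin m) → Fin r → ℕ) (lam : ℕ → ℝ) : Prop :=
  IsPartitionOfUnity lam ∧
    ∀ lam', IsPartitionOfUnity lam' → partitionDensity S a lam' ≤ partitionDensity S a lam

/-- `S` is simple: the supremum over all partitions of unity is achieved with a partition
that has exactly `r` parts, where `r` is the common number of layers. -/
def IsSimpleSet {m r : ℕ} (S : Finset (Equiv.Perm (Fin m)))
    (a : Equiv.Perm (Fin m) → Fin r → ℕ) : Prop :=
  ∃ lam, IsOptimalPartition S a lam ∧ (Function.support lam).encard = (r : ℕ∞)

end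

/-! ### General properties of the packing density -/

/-! The proof has two halves: the packing density is the optimum of a polynomial in chain weights,
and an increasing optimal weight sequence can be taken to have r parts.

For the upper bound on occurrences, fix a word `σ` and write `R i j` when `i < j` and `σ i < σ j`. A
layered pattern is determined by which pairs of its positions lie in increasing layers, so each
occurrence, read in any of its `m!` orders, is a tuple whose `R`-comparisons are those of its
layers. Drawing tuples from a weight on positions, two `R`-incomparable points can be merged by a
symmetrization in the style of Zykov: moving all mass of the pair to one or the other point,
averaged suitably, does not decrease the probability (`tupleProb_move_mass_le`). Iterating leaves a
weight on a chain, where the probability is at most the multinomial times the chain sum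
(`sum_tupleProb_le`). Words with blocks of lengths about `μ i * n` attain the bound asymptotically,
and `hasPackingDensity_of_bounds` turns this into both iterated limits.

For simplicity, an increasing summable sequence has finitely many parts. Let `x ≤ y` be the two
smallest of n parts. Merging them loses only the chains using both, and gains `(x+y)^a - x^a - y^a ≥
(2^a - 2) x^a ≥ (r-1) x^a` times the chain sum of the remaining exponents over the other parts. An
insertion count (`mul_listChainSum_le`) shows that the gain exceeds the loss by at least n-r-1 times
a positive quantity (`listChainSum_merge`). Optimality thus forces n ≤ r+1, and if n = r+1 a single
merge yields an optimal partition with r parts. -/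

theorem card_orderEmbedding_fin (m n : ℕ) : Nat.card (Fin m ↪o Fin n) = n.choose m := by
  rw [Nat.card_congr (Set.powersetCard.ofFinEmbEquiv (n := m) (I := Fin n)),
    Set.powersetCard.card]
  simp

section Density

variable {l m k n : ℕ} (P : Set (Fin m → Fin l))

theorem numOccurrences_le_choose (σ : Fin n → Fin k) : numOccurrences P σ ≤ n.choose m := by
  rw [← card_orderEmbedding_fin, numOccurrences]
  exact Set.ncard_le_card _

theorem numOccurrences_le_maxOccurrences (σ : Fin n → Fin k) :
    numOccurrences P σ ≤ maxOccurrences P k n :=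
  Finset.le_sup (f := fun σ : Fin n → Fin k => numOccurrences P σ) (Finset.mem_univ σ)

theorem maxOccurrences_le {N : ℕ} (h : ∀ σ : Fin n → Fin k, numOccurrences P σ ≤ N) :
    maxOccurrences P k n ≤ N :=
  Finset.sup_le fun σ _ => h σ

theorem maxOccurrences_mono_letters (n : ℕ) : Monotone fun k => maxOccurrences P k n := by
  intro k k' h
  refine maxOccurrences_le P fun σ => ?_
  exact numOccurrences_le_maxOccurrences P fun i => Fin.castLE h (σ i)

theorem maxDensity_mono_letters (n : ℕ) : Monotone fun k => maxDensity P k n := by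
  intro k k' h
  have := maxOccurrences_mono_letters P n h
  simp only [maxDensity]
  gcongr

theorem maxDensity_nonneg (k n : ℕ) : 0 ≤ maxDensity P k n := by
  unfold maxDensity
  positivity

theorem maxDensity_le_one (k n : ℕ) : maxDensity P k n ≤ 1 := by
  unfold maxDensity
  refine div_le_one_of_le₀ ?_ (by positivity)
  exact_mod_cast maxOccurrences_le P (numOccurrences_le_choose P)

/-- Double counting of pairs of an occurrence and a position outside it: each occurrence survives
the deletion of any of the `n + 1 - m` positions that it misses. Averaging makes the density
decrease with the word length. -/
theorem numOccurrences_succ_le (σ : Fin (n + 1) → Fin k) :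
    (n + 1 - m) * numOccurrences P σ ≤ ∑ i : Fin (n + 1), numOccurrences P fun j => σ (i.succAbove j) := by
  classical
  set A : Finset (Fin m ↪o Fin (n + 1)) :=
    Finset.univ.filter fun f => ∃ p ∈ P, IsOccurrence p σ f with hA
  have hcard : numOccurrences P σ = A.card := by
    rw [numOccurrences, ← Set.ncard_coe_finset]
    congr 1
    ext f
    simp [hA]
  have h1 : ∑ f ∈ A, (Finset.univ.filter fun i => i ∉ Set.range f).card =
      (n + 1 - m) * A.card := by
    rw [Finset.sum_const_nat (m := n + 1 - m), mul_comm]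
    intro f _
    have : (Finset.univ.filter fun i => i ∉ Set.range f) =
        (Finset.univ.map f.toEmbedding)ᶜ := by
      ext i
      simp
    rw [this, Finset.card_compl]
    simp
  rw [hcard, ← h1]
  simp_rw [Finset.card_filter]
  rw [Finset.sum_comm]
  refine Finset.sum_le_sum fun i _ => ?_
  rw [← Finset.card_filter, numOccurrences, ← Set.ncard_coe_finset]
  have hsub : (↑(A.filter fun f : Fin m ↪o Fin (n + 1) => i ∉ Set.range f) : Set (Fin m ↪o Fin (n + 1))) ⊆
      (fun g : Fin m ↪o Fin n => g.trans (Fin.succAboveOrderEmb i)) ''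
        {g | ∃ p ∈ P, IsOccurrence p (fun j => σ (i.succAbove j)) g} := by
    intro f hf
    simp only [hA, Finset.coe_filter, Finset.mem_filter, Finset.mem_univ, true_and,
      Set.mem_ofPred_eq] at hf
    obtain ⟨⟨p, hp, hocc⟩, hi⟩ := hf
    have hex : ∀ q, ∃ z, i.succAbove z = f q := fun q =>
      Fin.exists_succAbove_eq fun h => hi ⟨q, h⟩
    choose g hg using hex
    have hmono : StrictMono g := fun q q' h => by
      rw [← Fin.succAbove_lt_succAbove_iff (p := i), hg, hg]
      exact f.strictMono h
    refine ⟨OrderEmbedding.ofStrictMono g hmono, ⟨p, hp, ?_⟩, ?_⟩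
    · intro q q'
      simpa [hg] using hocc q q'
    · ext q
      simp [hg]
  exact (Set.ncard_le_ncard hsub).trans (Set.ncard_image_le)

theorem maxOccurrences_succ_le (k n : ℕ) :
    (n + 1 - m) * maxOccurrences P k (n + 1) ≤ (n + 1) * maxOccurrences P k n := by
  rcases Nat.eq_zero_or_pos (n + 1 - m) with h0 | hpos
  · simp [h0]
  rw [mul_comm, ← Nat.le_div_iff_mul_le hpos]
  refine maxOccurrences_le P fun σ => ?_
  rw [Nat.le_div_iff_mul_le hpos, mul_comm]
  refine (numOccurrences_succ_le P σ).trans ?_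
  refine (Finset.sum_le_card_nsmul _ _ (maxOccurrences P k n) fun i _ =>
    numOccurrences_le_maxOccurrences P _).trans ?_
  simp

theorem maxDensity_succ_le (k : ℕ) (h : m ≤ n) : maxDensity P k (n + 1) ≤ maxDensity P k n := by
  have h1 := maxOccurrences_succ_le P k n
  have h2 : (n + 1) * n.choose m = (n + 1).choose m * (n + 1 - m) := by
    rw [mul_comm]; exact Nat.choose_mul_succ_eq n m
  have hc : 0 < n.choose m := Nat.choose_pos h
  have hc' : 0 < (n + 1).choose m := Nat.choose_pos (by omega)
  have hd : 0 < n + 1 - m := by omega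
  unfold maxDensity
  rw [div_le_div_iff₀ (by exact_mod_cast hc') (by exact_mod_cast hc)]
  norm_cast
  refine Nat.le_of_mul_le_mul_left (c := (n + 1)) ?_ (Nat.succ_pos n)
  calc (n + 1) * (maxOccurrences P k (n + 1) * n.choose m)
      = maxOccurrences P k (n + 1) * ((n + 1) * n.choose m) := by ring
    _ = (n + 1).choose m * ((n + 1 - m) * maxOccurrences P k (n + 1)) := by rw [h2]; ring
    _ ≤ (n + 1).choose m * ((n + 1) * maxOccurrences P k n) := Nat.mul_le_mul_left _ h1
    _ = (n + 1) * (maxOccurrences P k n * (n + 1).choose m) := by ring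

/-- Repeat every letter of an optimal word `q` times; each occurrence then lifts to `q ^ m`
occurrences, one for each choice of copies. This bounds from below the limit in `n` over a fixed
alphabet. -/
theorem pow_mul_maxOccurrences_le (k n q : ℕ) :
    q ^ m * maxOccurrences P k n ≤ maxOccurrences P k (n * q) := by
  classical
  rcases Nat.eq_zero_or_pos (q ^ m) with h0 | hpos
  · simp [h0]
  rw [mul_comm, ← Nat.le_div_iff_mul_le hpos]
  refine maxOccurrences_le P fun σ => ?_
  rw [Nat.le_div_iff_mul_le hpos]
  refine le_trans ?_ (numOccurrences_le_maxOccurrences P fun i : Fin (n * q) => σ i.divNat)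
  have hmono : ∀ (f : Fin m ↪o Fin n) (c : Fin m → Fin q),
      StrictMono fun p => finProdFinEquiv (f p, c p) := by
    intro f c p p' hp
    have hf : (f p : ℕ) + 1 ≤ f p' := f.strictMono hp
    have := (c p).2
    have h3 := Nat.mul_le_mul_left q hf
    rw [Fin.lt_def]
    simp only [finProdFinEquiv_apply_val]
    rw [Nat.mul_add] at h3
    omega
  have hinj : Function.Injective fun x : (Fin m ↪o Fin n) × (Fin m → Fin q) =>
      OrderEmbedding.ofStrictMono _ (hmono x.1 x.2) := by
    rintro ⟨f, c⟩ ⟨f', c'⟩ h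
    have h' : ∀ p, (f p, c p) = (f' p, c' p) := fun p =>
      finProdFinEquiv.injective (DFunLike.congr_fun h p)
    simp only [Prod.mk.injEq] at h' ⊢
    exact ⟨DFunLike.ext _ _ fun p => (h' p).1, funext fun p => (h' p).2⟩
  have hdiv : ∀ (i : Fin n) (j : Fin q), (finProdFinEquiv (i, j)).divNat = i := fun i j =>
    congrArg Prod.fst (finProdFinEquiv.symm_apply_apply (i, j))
  have hc : numOccurrences P σ * q ^ m = Set.ncard
      ({f : Fin m ↪o Fin n | ∃ p ∈ P, IsOccurrence p σ f} ×ˢ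
        (Set.univ : Set (Fin m → Fin q))) := by
    rw [Set.ncard_prod, numOccurrences, Set.ncard_univ]
    simp
  rw [hc, ← Set.ncard_image_of_injective _ hinj]
  refine Set.ncard_le_ncard ?_
  rintro _ ⟨⟨f, c⟩, ⟨⟨p, hp, hocc⟩, -⟩, rfl⟩
  refine ⟨p, hp, fun i j => ?_⟩
  simpa [hdiv] using hocc i j

theorem tendsto_pow_div_factorial_mul_choose (m : ℕ) :
    Tendsto (fun n : ℕ => (n : ℝ) ^ m / (m.factorial * n.choose m)) atTop (𝓝 1) := by
  have h := (isEquivalent_choose m).symm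
  have h2 := (Asymptotics.isEquivalent_iff_tendsto_one ?_).1 h
  · refine h2.congr fun n => ?_
    simp only [Pi.div_apply]
    rw [div_div]
  · filter_upwards [eventually_ge_atTop m] with n hn
    exact_mod_cast (Nat.choose_pos hn).ne'

theorem factorial_mul_choose_le_pow (m n : ℕ) : m.factorial * n.choose m ≤ n ^ m := by
  rw [← Nat.descFactorial_eq_factorial_mul_choose]
  exact Nat.descFactorial_le_pow n m

/-- If the number of occurrences in words of length `n` is at most `D * n ^ m / m!`, and if this
bound is asymptotically attained, then the packing density is `D`. -/
theorem hasPackingDensity_of_bounds {D : ℝ} (N : ℕ → ℕ)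
    (hup : ∀ k n, (maxOccurrences P k n : ℝ) * m.factorial ≤ D * n ^ m)
    (hlow : Tendsto (fun n => (maxOccurrences P (N n) n : ℝ) * m.factorial / n ^ m) atTop (𝓝 D)) :
    HasPackingDensity P D := by
  have hbound : ∀ k n, m ≤ n →
      maxDensity P k n ≤ D * ((n : ℝ) ^ m / (m.factorial * n.choose m)) := by
    intro k n h
    have hc : (0 : ℝ) < n.choose m := by exact_mod_cast Nat.choose_pos h
    have hf : (0 : ℝ) < m.factorial := by exact_mod_cast m.factorial_pos
    rw [maxDensity, ← mul_div_assoc, div_le_div_iff₀ hc (by positivity)]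
    nlinarith [mul_le_mul_of_nonneg_right (hup k n) hc.le]
  have hlim : Tendsto (fun n : ℕ => D * ((n : ℝ) ^ m / (m.factorial * n.choose m))) atTop
      (𝓝 D) := by
    simpa using (tendsto_pow_div_factorial_mul_choose m).const_mul D
  have hfac : ∀ x : ℝ, 0 ≤ x → ∀ n, m ≤ n →
      x * m.factorial / (n : ℝ) ^ m ≤ x / n.choose m := by
    intro x hx n h
    have hc : (0 : ℝ) < n.choose m := by exact_mod_cast Nat.choose_pos h
    have h1 : ((m.factorial * n.choose m : ℕ) : ℝ) ≤ ((n ^ m : ℕ) : ℝ) := by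
      exact_mod_cast factorial_mul_choose_le_pow m n
    push_cast at h1
    have hf : (0 : ℝ) < m.factorial := by exact_mod_cast m.factorial_pos
    rw [div_le_div_iff₀ (lt_of_lt_of_le (by positivity) h1) hc]
    nlinarith [mul_le_mul_of_nonneg_left h1 hx]
  refine ⟨⟨fun n => ⨆ k, maxDensity P k n, fun n => ?_, ?_⟩, ?_⟩
  · exact tendsto_atTop_ciSup (maxDensity_mono_letters P n)
      ⟨1, by rintro _ ⟨k, rfl⟩; exact maxDensity_le_one P k n⟩
  · refine tendsto_of_tendsto_of_tendsto_of_le_of_le' hlow hlim ?_ ?_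
    · filter_upwards [eventually_ge_atTop m] with n hn
      refine (hfac _ (by positivity) n hn).trans ?_
      exact le_ciSup (f := fun k => maxDensity P k n)
        ⟨1, by rintro _ ⟨k, rfl⟩; exact maxDensity_le_one P k n⟩ (N n)
    · filter_upwards [eventually_ge_atTop m] with n hn
      exact ciSup_le fun k => hbound k n hn
  -- The density decreases only from length `m` on, since before that the binomial coefficient
  -- vanishes; hence the shift by `m`.
  · have hex : ∀ k, ∃ b, Tendsto (fun n => maxDensity P k n) atTop (𝓝 b) := by
      intro k
      have hanti : Antitone fun n => maxDensity P k (n + m) :=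
        antitone_nat_of_succ_le fun n => by
          rw [Nat.add_right_comm]
          exact maxDensity_succ_le P k (by omega)
      have := tendsto_atTop_ciInf hanti
        ⟨0, by rintro _ ⟨n, rfl⟩; exact maxDensity_nonneg P k _⟩
      exact ⟨_, (tendsto_add_atTop_iff_nat m).1 this⟩
    choose b hb using hex
    refine ⟨b, hb, ?_⟩
    have hbD : ∀ k, b k ≤ D := fun k => by
      refine le_of_tendsto_of_tendsto (hb k) hlim ?_
      filter_upwards [eventually_ge_atTop m] with n hn
      exact hbound k n hn
    have hbL : ∀ n, 0 < n → ∀ k, N n ≤ k →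
        (maxOccurrences P (N n) n : ℝ) * m.factorial / n ^ m ≤ b k := by
      intro n hn k hk
      -- The limit for a fixed alphabet exists, so it can be computed along multiples of `n`, where
      -- blown-up words give the lower bound.
      have hsub : Tendsto (fun q => maxDensity P k (n * q)) atTop (𝓝 (b k)) :=
        (hb k).comp (tendsto_id.const_mul_atTop' hn)
      refine ge_of_tendsto hsub ?_
      filter_upwards [eventually_ge_atTop (m + 1)] with q hq
      have h1 : ((q ^ m * maxOccurrences P k n : ℕ) : ℝ) ≤ maxOccurrences P k (n * q) := by
        exact_mod_cast pow_mul_maxOccurrences_le P k n q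
      have h2 : (maxOccurrences P (N n) n : ℝ) ≤ maxOccurrences P k n := by
        exact_mod_cast maxOccurrences_mono_letters P n hk
      push_cast at h1
      have hq0 : (0 : ℝ) < q := by exact_mod_cast (by omega : 0 < q)
      have hn0 : (0 : ℝ) < n := by exact_mod_cast hn
      have hle : m ≤ n * q := by nlinarith
      calc (maxOccurrences P (N n) n : ℝ) * m.factorial / n ^ m
          = (q ^ m * maxOccurrences P (N n) n : ℝ) * m.factorial / ((n * q : ℕ) : ℝ) ^ m := by
            push_cast
            rw [mul_pow]
            field_simp
        _ ≤ (maxOccurrences P k (n * q) : ℝ) * m.factorial / ((n * q : ℕ) : ℝ) ^ m := by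
            have : (q ^ m * maxOccurrences P (N n) n : ℝ) ≤ maxOccurrences P k (n * q) :=
              le_trans (by gcongr) h1
            gcongr
        _ ≤ maxDensity P k (n * q) := hfac _ (by positivity) _ hle
    refine tendsto_order.2 ⟨fun x hx => ?_, fun x hx => ?_⟩
    · obtain ⟨n, hn, hn0⟩ := ((hlow.eventually_const_lt hx).and (eventually_gt_atTop 0)).exists
      filter_upwards [eventually_ge_atTop (N n)] with k hk
      exact hn.trans_le (hbL n hn0 k hk)
    · exact Eventually.of_forall fun k => (hbD k).trans_lt hx

end Density

/-! ### Moving mass between incomparable points -/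

/-- The tuple `z` is, with respect to the relation `R`, weakly ordered with blocks of sizes
`a 0, …, a (r - 1)`. -/
def IsLayeredTuple {X : Type*} {m r : ℕ} (R : X → X → Prop) (a : Fin r → ℕ) (z : Fin m → X) :
    Prop :=
  ∃ b : Fin m → Fin r, (∀ i, a i = (Finset.univ.filter fun p => b p = i).card) ∧
    ∀ p q, R (z p) (z q) ↔ b p < b q

/-- Incomparable points that both occur in a layered tuple lie in the same layer, as do all their
copies. Exchanging them arbitrarily therefore keeps every comparison between layers, with the same
layer map. -/
theorem IsLayeredTuple.subst {X : Type*} {m r : ℕ} {R : X → X → Prop} {a : Fin r → ℕ}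
    {z z' : Fin m → X} (h : IsLayeredTuple R a z) (hirr : ∀ x, ¬ R x x) {x y : X}
    (hxy : ¬ R x y) (hyx : ¬ R y x) (hx : ∃ p, z p = x) (hy : ∃ p, z p = y)
    (hz : ∀ p, z' p = z p ∨ ((z p = x ∨ z p = y) ∧ (z' p = x ∨ z' p = y))) :
    IsLayeredTuple R a z' := by
  obtain ⟨b, hb, hR⟩ := h
  obtain ⟨p₀, hp₀⟩ := hx
  obtain ⟨q₀, hq₀⟩ := hy
  have hpq : b p₀ = b q₀ := by
    have h1 := hR p₀ q₀
    have h2 := hR q₀ p₀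
    rw [hp₀, hq₀] at h1 h2
    exact le_antisymm (not_lt.1 fun h => hyx (h2.2 h)) (not_lt.1 fun h => hxy (h1.2 h))
  have hrep : ∀ p, ∃ p', z p' = z' p ∧ b p' = b p := by
    intro p
    rcases hz p with h | ⟨h1, h2⟩
    · exact ⟨p, h.symm, rfl⟩
    · have hbp : b p = b p₀ := by
        rcases h1 with h1 | h1
        · have e1 := hR p p₀
          have e2 := hR p₀ p
          rw [hp₀, h1] at e1 e2
          exact le_antisymm (not_lt.1 fun h => hirr x (e2.2 h)) (not_lt.1 fun h => hirr x (e1.2 h))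
        · have e1 := hR p q₀
          have e2 := hR q₀ p
          rw [hq₀, h1] at e1 e2
          rw [hpq]
          exact le_antisymm (not_lt.1 fun h => hirr y (e2.2 h)) (not_lt.1 fun h => hirr y (e1.2 h))
      rcases h2 with h2 | h2
      · exact ⟨p₀, hp₀.trans h2.symm, hbp.symm⟩
      · exact ⟨q₀, hq₀.trans h2.symm, by rw [← hpq, hbp]⟩
  refine ⟨b, hb, fun p q => ?_⟩
  obtain ⟨p', hp', hbp⟩ := hrep p
  obtain ⟨q', hq', hbq⟩ := hrep q
  rw [← hp', ← hq', hR, hbp, hbq]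

/-- `A` is the set of positions holding one of two incomparable points, `B` those holding the
second. If some mixed `B` counts then every `B` counts and both sides are `(s+t)^(|A|+1)`; otherwise
only the two pure terms remain, and `s^c, t^c ≤ (s+t)^c`. -/
theorem sum_powerset_two_weights_le {ι : Type*} [DecidableEq ι] (A : Finset ι) (J : Finset ι → ℝ)
    (h0 : ∀ B, 0 ≤ J B)
    (hJ : ∀ B ⊆ A, B ≠ ∅ → B ≠ A → J B ≠ 0 → ∀ C ⊆ A, J C = 1) {s t : ℝ} (hs : 0 ≤ s)
    (ht : 0 ≤ t) :
    (s + t) * ∑ B ∈ A.powerset, J B * (s ^ (A.card - B.card) * t ^ B.card) ≤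
      (s + t) ^ A.card * (s * J ∅ + t * J A) := by
  by_cases hmix : ∃ B ⊆ A, B ≠ ∅ ∧ B ≠ A ∧ J B ≠ 0
  · obtain ⟨B, hB, hB0, hBA, hBJ⟩ := hmix
    have hall := hJ B hB hB0 hBA hBJ
    rw [hall ∅ (Finset.empty_subset _), hall A subset_rfl]
    have : ∑ B ∈ A.powerset, J B * (s ^ (A.card - B.card) * t ^ B.card) = (t + s) ^ A.card := by
      rw [← Finset.sum_pow_mul_eq_add_pow]
      refine Finset.sum_congr rfl fun C hC => ?_
      rw [hall C (Finset.mem_powerset.1 hC)]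
      ring
    rw [this]
    exact le_of_eq (by ring)
  push Not at hmix
  -- For empty `A` the two pure choices coincide, so the two-term sum below would count one of them
  -- twice.
  rcases A.eq_empty_or_nonempty with rfl | hA
  · simp
    exact le_of_eq (by ring)
  have hsum : ∑ B ∈ A.powerset, J B * (s ^ (A.card - B.card) * t ^ B.card) =
      J ∅ * s ^ A.card + J A * t ^ A.card := by
    rw [← Finset.sum_subset (s₁ := {∅, A})]
    · rw [Finset.sum_pair hA.ne_empty.symm]
      simp
    · intro B hB
      simp only [Finset.mem_insert, Finset.mem_singleton] at hB
      rcases hB with rfl | rfl <;> simp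
    · intro B hB hB'
      simp only [Finset.mem_insert, Finset.mem_singleton, not_or] at hB'
      rw [hmix B (Finset.mem_powerset.1 hB) (Finset.nonempty_iff_ne_empty.2 hB'.1) hB'.2, zero_mul]
  obtain ⟨c, hc⟩ : ∃ c, A.card = c + 1 := ⟨A.card - 1, by have := hA.card_pos; omega⟩
  rw [hsum, hc]
  have e1 : s ^ c ≤ (s + t) ^ c := by gcongr; linarith
  have e2 : t ^ c ≤ (s + t) ^ c := by gcongr; linarith
  have f1 : (s + t) * s * J ∅ * s ^ c ≤ (s + t) * s * J ∅ * (s + t) ^ c := by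
    have := h0 ∅; gcongr
  have f2 : (s + t) * t * J A * t ^ c ≤ (s + t) * t * J A * (s + t) ^ c := by
    have := h0 A; gcongr
  calc _ = (s + t) * s * J ∅ * s ^ c + (s + t) * t * J A * t ^ c := by ring
    _ ≤ _ := add_le_add f1 f2
    _ = _ := by ring

section Tuples

variable {X ι : Type*} [Fintype X] [DecidableEq X] [Fintype ι] [DecidableEq ι]

/-- Tuples are grouped by the tuple `u` obtained on replacing every `y` by `x`; a tuple is recovered
from `u` and the set `B` of positions that held `y`. -/
theorem sum_tuples_eq_sum_subst (J : (ι → X) → ℝ) (w : X → ℝ) {x y : X} (hxy : x ≠ y) :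
    ∑ z, J z * ∏ p, w (z p) =
      ∑ u ∈ Finset.univ.filter (fun u : ι → X => ∀ p, u p ≠ y),
        (∏ p ∈ Finset.univ.filter (fun p => u p ≠ x), w (u p)) *
        ∑ B ∈ (Finset.univ.filter fun p => u p = x).powerset,
          J (fun p => if p ∈ B then y else u p) *
            (w x ^ ((Finset.univ.filter fun p => u p = x).card - B.card) * w y ^ B.card) := by
  simp_rw [Finset.mul_sum]
  rw [Finset.sum_sigma']
  refine Finset.sum_bij' (fun z _ => ⟨fun p => if z p = y then x else z p,
    Finset.univ.filter fun p => z p = y⟩) (fun v _ => fun p => if p ∈ v.2 then y else v.1 p)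
    ?_ ?_ ?_ ?_ ?_
  · intro z _
    simp only [Finset.mem_sigma, Finset.mem_filter, Finset.mem_univ, true_and,
      Finset.mem_powerset]
    refine ⟨fun p => ?_, fun p hp => ?_⟩
    · split_ifs with h
      · exact hxy
      · exact h
    · simp only [Finset.mem_filter, Finset.mem_univ, true_and] at hp ⊢
      simp [hp]
  · intro v _
    exact Finset.mem_univ _
  · intro z _
    funext p
    simp only [Finset.mem_filter, Finset.mem_univ, true_and]
    split_ifs with h
    · exact h.symm
    · rfl
  · rintro ⟨u, B⟩ hv
    simp only [Finset.mem_sigma, Finset.mem_filter, Finset.mem_univ, true_and,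
      Finset.mem_powerset] at hv
    obtain ⟨hu, hB⟩ := hv
    have hBx : ∀ p ∈ B, u p = x := fun p hp => by simpa using hB hp
    have e1 : (fun p => if (if p ∈ B then y else u p) = y then x else
        (if p ∈ B then y else u p)) = u := by
      funext p
      by_cases hp : p ∈ B
      · simp [hp, hBx p hp]
      · simp [hp, hu p]
    have e2 : (Finset.univ.filter fun p => (if p ∈ B then y else u p) = y) = B := by
      ext p
      by_cases hp : p ∈ B
      · simp [hp]
      · simp [hp, hu p]
    simp only [e1, e2]
  · intro z _
    have e0 : (fun p => if p ∈ (Finset.univ.filter fun p => z p = y) then y else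
        (if z p = y then x else z p)) = z := by
      funext p
      by_cases hp : z p = y <;> simp [hp]
    simp only [e0]
    rw [mul_left_comm]
    congr 1
    have hA : ∀ p, (if z p = y then x else z p) = x ↔ (z p = x ∨ z p = y) := by
      intro p
      by_cases hp : z p = y <;> simp [hp]
    have hcard : (Finset.univ.filter fun p => (if z p = y then x else z p) = x).card -
        (Finset.univ.filter fun p => z p = y).card =
        (Finset.univ.filter fun p => z p = x).card := by
      simp_rw [hA]
      rw [Finset.filter_or, Finset.card_union_of_disjoint, Nat.add_sub_cancel]
      rw [Finset.disjoint_filter]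
      rintro p _ h1 h2
      exact hxy (h1.symm.trans h2)
    rw [hcard, ← Finset.prod_const, ← Finset.prod_const, ← Finset.prod_filter_mul_prod_filter_not
      Finset.univ (fun p => (if z p = y then x else z p) ≠ x)]
    congr 1
    · refine Finset.prod_congr rfl fun p hp => ?_
      simp only [Finset.mem_filter, Finset.mem_univ, true_and, ne_eq, hA, not_or] at hp
      rw [if_neg hp.2]
    · have : (Finset.univ.filter fun p => ¬ (if z p = y then x else z p) ≠ x) =
          (Finset.univ.filter fun p => z p = x) ∪ (Finset.univ.filter fun p => z p = y) := by
        rw [← Finset.filter_or]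
        ext p
        simp only [ne_eq, not_not, Finset.mem_filter, Finset.mem_univ, true_and, hA]
      rw [this, Finset.prod_union]
      · congr 1
        · refine Finset.prod_congr rfl fun p hp => ?_
          rw [(Finset.mem_filter.1 hp).2]
        · refine Finset.prod_congr rfl fun p hp => ?_
          rw [(Finset.mem_filter.1 hp).2]
      · rw [Finset.disjoint_filter]
        rintro p _ h1 h2
        exact hxy (h1.symm.trans h2)

theorem sum_tuples_move_mass_le (J : (ι → X) → ℝ) (h0 : ∀ z, 0 ≤ J z)
    {w : X → ℝ} (hw : ∀ t, 0 ≤ w t) {x y : X} (hxy : x ≠ y)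
    (hJ : ∀ z, J z ≠ 0 → (∃ p, z p = x) → (∃ p, z p = y) → ∀ z' : ι → X,
      (∀ p, z' p = z p ∨ ((z p = x ∨ z p = y) ∧ (z' p = x ∨ z' p = y))) → J z' = 1) :
    (w x + w y) * ∑ z, J z * ∏ p, w (z p) ≤
      w x * ∑ z, J z * ∏ p, Function.update (Function.update w x (w x + w y)) y 0 (z p) +
      w y * ∑ z, J z * ∏ p, Function.update (Function.update w x 0) y (w x + w y) (z p) := by
  rw [sum_tuples_eq_sum_subst J w hxy, sum_tuples_eq_sum_subst J _ hxy,
    sum_tuples_eq_sum_subst J _ hxy, Finset.mul_sum, Finset.mul_sum, Finset.mul_sum,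
    ← Finset.sum_add_distrib]
  refine Finset.sum_le_sum fun u hu => ?_
  replace hu : ∀ p, u p ≠ y := by simpa using hu
  set A := Finset.univ.filter fun p => u p = x with hA
  have hprod : ∀ c d : ℝ, ∏ p ∈ Finset.univ.filter (fun p => u p ≠ x),
      Function.update (Function.update w x c) y d (u p) =
      ∏ p ∈ Finset.univ.filter (fun p => u p ≠ x), w (u p) := by
    intro c d
    refine Finset.prod_congr rfl fun p hp => ?_
    rw [Function.update_of_ne (hu p), Function.update_of_ne (Finset.mem_filter.1 hp).2]
  rw [hprod, hprod]
  simp only [Function.update_self, Function.update_of_ne hxy]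
  set O := ∏ p ∈ Finset.univ.filter (fun p => u p ≠ x), w (u p) with hO
  have hO0 : 0 ≤ O := Finset.prod_nonneg fun p _ => hw _
  have s1 : ∑ B ∈ A.powerset, J (fun p => if p ∈ B then y else u p) *
      ((w x + w y) ^ (A.card - B.card) * 0 ^ B.card) =
      J (fun p => if p ∈ (∅ : Finset ι) then y else u p) * (w x + w y) ^ A.card := by
    -- With no mass on `y`, only the choice that puts `x` at every position of `A` has nonzero
    -- weight.
    rw [Finset.sum_eq_single ∅]
    · simp
    · intro B _ hB
      rw [zero_pow (Finset.card_ne_zero.2 (Finset.nonempty_iff_ne_empty.2 hB))]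
      simp
    · simp
  have s2 : ∑ B ∈ A.powerset, J (fun p => if p ∈ B then y else u p) *
      (0 ^ (A.card - B.card) * (w x + w y) ^ B.card) =
      J (fun p => if p ∈ A then y else u p) * (w x + w y) ^ A.card := by
    rw [Finset.sum_eq_single A]
    · simp
    · intro B hB hBA
      have := Finset.card_lt_card (lt_of_le_of_ne (Finset.mem_powerset.1 hB) hBA)
      rw [zero_pow (by omega)]
      simp
    · simp
  rw [s1, s2]
  have key := sum_powerset_two_weights_le A (fun B => J fun p => if p ∈ B then y else u p)
    (fun B => h0 _) ?_ (hw x) (hw y)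
  · have := mul_le_mul_of_nonneg_left key hO0
    calc _ = O * ((w x + w y) * ∑ B ∈ A.powerset, J (fun p => if p ∈ B then y else u p) *
          (w x ^ (A.card - B.card) * w y ^ B.card)) := by ring
      _ ≤ _ := this
      _ = _ := by ring
  · intro B hB hB0 hBA hne C hC
    have hBx : ∀ p ∈ B, u p = x := fun p hp => by simpa [hA] using hB hp
    have hCx : ∀ p ∈ C, u p = x := fun p hp => by simpa [hA] using hC hp
    refine hJ _ hne ?_ ?_ _ ?_
    · obtain ⟨p, hpA, hpB⟩ := Finset.exists_of_ssubset (lt_of_le_of_ne hB hBA)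
      exact ⟨p, by simpa [hpB, hA] using hpA⟩
    · obtain ⟨p, hp⟩ := Finset.nonempty_iff_ne_empty.2 hB0
      exact ⟨p, by simp [hp]⟩
    · intro p
      by_cases hpB : p ∈ B <;> by_cases hpC : p ∈ C
      · simp [hpB, hpC]
      · simp [hpB, hpC, hBx p hpB]
      · simp [hpB, hpC, hCx p hpC]
      · simp [hpB, hpC]

end Tuples

/-! ### The number of maps with prescribed fibre sizes -/

theorem prod_comp_eq_prod_pow_card_fiber {M : Type*} [CommMonoid M] {m r : ℕ} (b : Fin m → Fin r)
    (f : Fin r → M) :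
    ∏ p, f (b p) = ∏ i, f i ^ (Finset.univ.filter fun p => b p = i).card := by
  rw [← Finset.prod_fiberwise Finset.univ b]
  refine Finset.prod_congr rfl fun i _ => ?_
  rw [← Finset.prod_const]
  refine Finset.prod_congr rfl fun p hp => ?_
  rw [(Finset.mem_filter.1 hp).2]

/-- Both sides are the coefficient of the monomial with exponents `a` in `(∑ X i) ^ m`, computed by
expanding over all maps and by the multinomial theorem. -/
theorem card_maps_with_fibers {m r : ℕ} (a : Fin r → ℕ) (ha : ∑ i, a i = m) :
    (Finset.univ.filter fun b : Fin m → Fin r =>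
      ∀ i, a i = (Finset.univ.filter fun p => b p = i).card).card =
      Nat.multinomial Finset.univ a := by
  classical
  have hX : ∀ k : Fin r → ℕ, ∏ i, (MvPolynomial.X i : MvPolynomial (Fin r) ℕ) ^ k i =
      MvPolynomial.monomial (Finsupp.equivFunOnFinite.symm k) 1 := by
    intro k
    rw [MvPolynomial.monomial_eq, Finsupp.prod_fintype]
    · simp
    · simp
  have hco : ∀ k : Fin r → ℕ, MvPolynomial.coeff (Finsupp.equivFunOnFinite.symm a)
      (∏ i, (MvPolynomial.X i : MvPolynomial (Fin r) ℕ) ^ k i) = if k = a then 1 else 0 := by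
    intro k
    rw [hX, MvPolynomial.coeff_monomial]
    simp
  have h1 : MvPolynomial.coeff (Finsupp.equivFunOnFinite.symm a)
      ((∑ i, (MvPolynomial.X i : MvPolynomial (Fin r) ℕ)) ^ m) =
      Nat.multinomial Finset.univ a := by
    rw [Finset.sum_pow_eq_sum_piAntidiag, MvPolynomial.coeff_sum,
      Finset.sum_eq_single_of_mem a (by simp [Finset.mem_piAntidiag, ha])]
    · rw [← MvPolynomial.C_eq_coe_nat, MvPolynomial.coeff_C_mul, hco]
      simp
    · intro k _ hk
      rw [← MvPolynomial.C_eq_coe_nat, MvPolynomial.coeff_C_mul, hco, if_neg hk, mul_zero]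
  rw [← h1, Fintype.sum_pow, MvPolynomial.coeff_sum, Finset.card_filter]
  refine Finset.sum_congr rfl fun b _ => ?_
  rw [prod_comp_eq_prod_pow_card_fiber, hco]
  congr 1
  rw [funext_iff]
  simp only [eq_comm]

theorem sum_fibers_eq {m r : ℕ} (a : Fin r → ℕ) (b : Fin m → Fin r)
    (hb : ∀ i, a i = (Finset.univ.filter fun p => b p = i).card) : ∑ i, a i = m := by
  simp_rw [hb]
  rw [Finset.sum_card_fiberwise_eq_card_filter]
  simp

/-! ### The upper bound for the number of occurrences -/

/-- The sum of `λ_{i₁}^{a₁} ⋯ λ_{i_r}^{a_r}` over `i₁ < ⋯ < i_r`, for finitely many `λ_i`. -/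
noncomputable def chainSum {r n : ℕ} (a : Fin r → ℕ) (w : Fin n → ℝ) : ℝ :=
  ∑ f : Fin r ↪o Fin n, ∏ j, w (f j) ^ a j

section Upper

open Classical in
/-- The probability that a random tuple is a layered tuple. -/
noncomputable def tupleProb {r n : ℕ} (m : ℕ) (R : Fin n → Fin n → Prop) (a : Fin r → ℕ) (w : Fin n → ℝ) : ℝ :=
  ∑ z : Fin m → Fin n, (if IsLayeredTuple R a z then 1 else 0) * ∏ p, w (z p)

/-- On a chain `R` is the order of the indices, so members of one layer are equal. A layered tuple
of nonzero weight is then an increasing choice of `r` points composed with a layer map, and the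
multinomial coefficient counts the layer maps. -/
theorem tupleProb_le_of_chain {m r n : ℕ} {R : Fin n → Fin n → Prop} (hR : ∀ i j, R i j → i < j)
    {a : Fin r → ℕ} (ha : ∀ i, 0 < a i) {w : Fin n → ℝ} (hw : ∀ t, 0 ≤ w t)
    (hchain : ∀ x y, w x ≠ 0 → w y ≠ 0 → x < y → R x y) :
    tupleProb m R a w ≤ (Nat.multinomial Finset.univ a : ℝ) * chainSum a w := by
  classical
  set B := Finset.univ.filter fun b : Fin m → Fin r =>
      ∀ i, a i = (Finset.univ.filter fun p => b p = i).card with hB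
  have hBcard : (B.card : ℝ) ≤ Nat.multinomial Finset.univ a := by
    by_cases hm : ∑ i, a i = m
    · rw [hB, card_maps_with_fibers a hm]
    · have : B = ∅ := by
        refine Finset.eq_empty_of_forall_notMem fun b hb => hm ?_
        exact sum_fibers_eq a b (Finset.mem_filter.1 hb).2
      rw [this]
      simp
  have hnn : 0 ≤ chainSum a w :=
    Finset.sum_nonneg fun f _ => Finset.prod_nonneg fun j _ => pow_nonneg (hw _) _
  refine le_trans ?_ (mul_le_mul_of_nonneg_right hBcard hnn)
  have e1 : (B.card : ℝ) * chainSum a w =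
      ∑ x ∈ (Finset.univ : Finset (Fin r ↪o Fin n)) ×ˢ B, ∏ p, w (x.1 (x.2 p)) := by
    rw [Finset.sum_product, chainSum, Finset.mul_sum]
    refine Finset.sum_congr rfl fun f _ => ?_
    rw [← nsmul_eq_mul, ← Finset.sum_const]
    refine Finset.sum_congr rfl fun b hb => ?_
    rw [prod_comp_eq_prod_pow_card_fiber b fun i => w (f i)]
    refine Finset.prod_congr rfl fun i _ => ?_
    rw [(Finset.mem_filter.1 hb).2]
  rw [e1]
  have hnn' : ∀ z : Fin m → Fin n, 0 ≤ ∏ p, w (z p) := fun z => Finset.prod_nonneg fun p _ => hw _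
  have e2 : tupleProb m R a w =
      ∑ z ∈ Finset.univ.filter (fun z : Fin m → Fin n => IsLayeredTuple R a z ∧ ∀ p, w (z p) ≠ 0),
        ∏ p, w (z p) := by
    rw [tupleProb, Finset.sum_filter]
    refine Finset.sum_congr rfl fun z _ => ?_
    by_cases h1 : IsLayeredTuple R a z
    · by_cases h2 : ∀ p, w (z p) ≠ 0
      · simp [h1, h2]
      · simp only [h1, h2, and_false, if_false]
        push Not at h2
        obtain ⟨p, hp⟩ := h2
        rw [Finset.prod_eq_zero (Finset.mem_univ p) hp, mul_zero]
    · simp [h1]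
  rw [e2]
  have hsub : Finset.univ.filter (fun z : Fin m → Fin n =>
      IsLayeredTuple R a z ∧ ∀ p, w (z p) ≠ 0) ⊆
      ((Finset.univ : Finset (Fin r ↪o Fin n)) ×ˢ B).image fun x p => x.1 (x.2 p) := by
    intro z hz
    obtain ⟨⟨b, hb, hz1⟩, hz2⟩ := (Finset.mem_filter.1 hz).2
    have hlt : ∀ p q, z p < z q ↔ b p < b q := by
      intro p q
      rw [← hz1]
      exact ⟨hchain _ _ (hz2 p) (hz2 q), hR _ _⟩
    have heq : ∀ p q, b p = b q → z p = z q := fun p q h =>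
      le_antisymm (not_lt.1 fun h' => ((hlt q p).1 h').ne h.symm)
        (not_lt.1 fun h' => ((hlt p q).1 h').ne h)
    have hsurj : ∀ i, ∃ p, b p = i := by
      intro i
      have := ha i
      rw [hb, Finset.card_pos] at this
      obtain ⟨p, hp⟩ := this
      exact ⟨p, (Finset.mem_filter.1 hp).2⟩
    choose s hs using hsurj
    have hmono : StrictMono fun i => z (s i) := fun i j hij => by
      rw [hlt, hs, hs]
      exact hij
    refine Finset.mem_image.2 ⟨(OrderEmbedding.ofStrictMono _ hmono, b), ?_, ?_⟩
    · simpa [hB] using hb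
    · funext p
      exact heq _ _ (hs _)
  calc _ ≤ ∑ z ∈ ((Finset.univ : Finset (Fin r ↪o Fin n)) ×ˢ B).image fun x p => x.1 (x.2 p),
        ∏ p, w (z p) := Finset.sum_le_sum_of_subset_of_nonneg hsub fun z _ _ => hnn' z
    _ ≤ _ := Finset.sum_image_le_of_nonneg fun z _ => hnn' z

theorem tupleProb_move_mass_le {m r n : ℕ} {R : Fin n → Fin n → Prop} (hR : ∀ i, ¬ R i i)
    (a : Fin r → ℕ) {w : Fin n → ℝ} (hw : ∀ t, 0 ≤ w t) {x y : Fin n} (hne : x ≠ y)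
    (hxy : ¬ R x y) (hyx : ¬ R y x) :
    (w x + w y) * tupleProb m R a w ≤
      w x * tupleProb m R a (Function.update (Function.update w x (w x + w y)) y 0) +
      w y * tupleProb m R a (Function.update (Function.update w x 0) y (w x + w y)) := by
  classical
  refine sum_tuples_move_mass_le _ (fun z => ?_) hw hne ?_
  · split_ifs <;> simp
  · intro z hz hzx hzy z' hz'
    have hz0 : IsLayeredTuple R a z := by
      by_contra h
      exact hz (if_neg h)
    rw [if_pos (hz0.subst hR hxy hyx hzx hzy hz')]

/-- If a bound holds for weights supported on a chain, then it holds for all weights. -/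
theorem sum_tupleProb_le {α : Type*} {m r n : ℕ} {R : Fin n → Fin n → Prop}
    (hR : ∀ i j, R i j → i < j) (S : Finset α) (a : α → Fin r → ℕ)
    (ha : ∀ π ∈ S, ∀ i, 0 < a π i) {D : ℝ}
    (hD : ∀ w : Fin n → ℝ, (∀ t, 0 ≤ w t) → ∑ t, w t = 1 →
      ∑ π ∈ S, (Nat.multinomial Finset.univ (a π) : ℝ) * chainSum (a π) w ≤ D) :
    ∀ (w : Fin n → ℝ), (∀ t, 0 ≤ w t) → ∑ t, w t = 1 →
      ∑ π ∈ S, tupleProb m R (a π) w ≤ D := by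
  classical
  suffices H : ∀ (N : ℕ) (w : Fin n → ℝ), (Finset.univ.filter fun t => w t ≠ 0).card ≤ N →
      (∀ t, 0 ≤ w t) → ∑ t, w t = 1 → ∑ π ∈ S, tupleProb m R (a π) w ≤ D from
    fun w => H _ w le_rfl
  have hirr : ∀ i, ¬ R i i := fun i h => (hR i i h).false
  intro N
  induction N with
  | zero =>
    intro w hN hw hsum
    have : ∀ t, w t = 0 := by simpa [Finset.filter_eq_empty_iff] using hN
    simp [this] at hsum
  | succ N ih =>
    intro w hN hw hsum
    by_cases hchain : ∀ x y, w x ≠ 0 → w y ≠ 0 → x < y → R x y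
    · exact (Finset.sum_le_sum fun π hπ =>
        tupleProb_le_of_chain hR (ha π hπ) hw hchain).trans (hD w hw hsum)
    push Not at hchain
    obtain ⟨x, y, hx, hy, hlt, hxy⟩ := hchain
    have hyx : ¬ R y x := fun h => (hR _ _ h).not_gt hlt
    have hx0 : 0 < w x := (hw x).lt_of_ne' hx
    have hy0 : 0 < w y := (hw y).lt_of_ne' hy
    have key := fun π => tupleProb_move_mass_le (m := m) hirr (a π) hw hlt.ne hxy hyx
    have hsplit : ∀ c d : ℝ, c + d = w x + w y →
        ∑ t, Function.update (Function.update w x c) y d t = 1 := by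
      intro c d hcd
      rw [← hsum, ← Finset.add_sum_erase _ _ (Finset.mem_univ y),
        ← Finset.add_sum_erase _ (fun t => w t) (Finset.mem_univ y),
        ← Finset.add_sum_erase (Finset.univ.erase y) _
          (Finset.mem_erase.2 ⟨hlt.ne, Finset.mem_univ x⟩),
        ← Finset.add_sum_erase (Finset.univ.erase y) (fun t => w t)
          (Finset.mem_erase.2 ⟨hlt.ne, Finset.mem_univ x⟩)]
      have : ∑ t ∈ (Finset.univ.erase y).erase x, Function.update (Function.update w x c) y d t =
          ∑ t ∈ (Finset.univ.erase y).erase x, w t := by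
        refine Finset.sum_congr rfl fun t ht => ?_
        simp only [Finset.mem_erase] at ht
        rw [Function.update_of_ne ht.2.1, Function.update_of_ne ht.1]
      rw [this]
      simp only [Function.update_self, Function.update_of_ne hlt.ne]
      linarith
    have hnn : ∀ c d : ℝ, 0 ≤ c → 0 ≤ d →
        ∀ t, 0 ≤ Function.update (Function.update w x c) y d t := by
      intro c d hc hd t
      rw [Function.update_apply, Function.update_apply]
      split_ifs
      exacts [hd, hc, hw t]
    have hsupp : ∀ (w' : Fin n → ℝ) (v : Fin n), w v ≠ 0 → w' v = 0 →
        (∀ t, w t = 0 → w' t = 0) → (Finset.univ.filter fun t => w' t ≠ 0).card ≤ N := by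
      intro w' v hv hv' hz
      have : (Finset.univ.filter fun t => w' t ≠ 0) ⊂ Finset.univ.filter fun t => w t ≠ 0 := by
        refine Finset.ssubset_iff_of_subset ?_ |>.2 ⟨v, by simpa using hv, by simpa using hv'⟩
        intro t ht
        simp only [Finset.mem_filter, Finset.mem_univ, true_and] at ht ⊢
        exact fun h => ht (hz t h)
      have := Finset.card_lt_card this
      omega
    have hzero : ∀ c d : ℝ, ∀ t, w t = 0 → Function.update (Function.update w x c) y d t = 0 := by
      intro c d t ht
      rw [Function.update_of_ne, Function.update_of_ne, ht]
      · rintro rfl; exact hx ht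
      · rintro rfl; exact hy ht
    have i1 := ih (Function.update (Function.update w x (w x + w y)) y 0)
      (hsupp _ y hy (by simp) (hzero _ _)) (hnn _ _ (by linarith) le_rfl)
      (hsplit _ _ (by ring))
    have i2 := ih (Function.update (Function.update w x 0) y (w x + w y))
      (hsupp _ x hx (by simp [Function.update_of_ne hlt.ne]) (hzero _ _))
      (hnn _ _ le_rfl (by linarith)) (hsplit _ _ (by ring))
    -- The averaging weights `w x` and `w y` do not depend on `π`, so the inequalities add over `S`.
    -- Choosing the better move for each `π` separately would not do.
    have hs := Finset.sum_le_sum fun π (_ : π ∈ S) => key π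
    rw [Finset.sum_add_distrib, ← Finset.mul_sum, ← Finset.mul_sum, ← Finset.mul_sum] at hs
    have hc : 0 < w x + w y := by linarith
    refine le_of_mul_le_mul_left ?_ hc
    nlinarith [mul_le_mul_of_nonneg_left i1 hx0.le, mul_le_mul_of_nonneg_left i2 hy0.le]

end Upper

section Layers

variable {m r : ℕ} {π : Equiv.Perm (Fin m)} {a : Fin r → ℕ}

theorem HasLayers.pos (h : HasLayers π a) (i : Fin r) : 0 < a i := by
  obtain ⟨b, -, hsurj, -, ha⟩ := h
  obtain ⟨p, hp⟩ := hsurj i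
  rw [ha, Finset.card_pos]
  exact ⟨p, by simp [hp]⟩

theorem HasLayers.sum_eq (h : HasLayers π a) : ∑ i, a i = m := by
  obtain ⟨b, -, -, -, ha⟩ := h
  exact sum_fibers_eq a b ha

/-- The layers are visible from comparisons of positions and values alone, which lets `R` detect
occurrences in a word. -/
theorem layer_lt_iff {b : Fin m → Fin r} (hb : Monotone b)
    (hπ : ∀ p q, p < q → (π q < π p ↔ b p = b q)) (p q : Fin m) :
    b p < b q ↔ p < q ∧ π p < π q := by
  constructor
  · intro h
    have hpq : p < q := not_le.1 fun h' => (hb h').not_gt h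
    refine ⟨hpq, lt_of_le_of_ne (not_lt.1 fun h' => ?_) fun h' => hpq.ne (π.injective h')⟩
    exact h.ne ((hπ p q hpq).1 h')
  · rintro ⟨h1, h2⟩
    exact lt_of_le_of_ne (hb h1.le) fun h' => h2.not_gt ((hπ p q h1).2 h')

end Layers

theorem orderEmbedding_comp_perm_injective (m n : ℕ) :
    Function.Injective fun (x : (Fin m ↪o Fin n) × Equiv.Perm (Fin m)) (p : Fin m) =>
      x.1 (x.2 p) := by
  rintro ⟨f, τ⟩ ⟨f', τ'⟩ h
  have h' : ∀ p, f (τ p) = f' (τ' p) := fun p => congrFun h p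
  have hf : f = f' := by
    refine DFunLike.coe_injective (StrictMono.range_inj f.strictMono f'.strictMono |>.1 ?_)
    ext t
    constructor
    · rintro ⟨p, rfl⟩
      exact ⟨τ' (τ.symm p), by rw [← h']; simp⟩
    · rintro ⟨p, rfl⟩
      exact ⟨τ (τ'.symm p), by rw [h']; simp⟩
  subst hf
  simp only [Prod.mk.injEq, true_and]
  exact Equiv.ext fun p => f.injective (h' p)

theorem numOccurrences_mul_factorial_le {m r k n : ℕ} (hm : 0 < m) (S : Finset (Equiv.Perm (Fin m)))
    (a : Equiv.Perm (Fin m) → Fin r → ℕ) (hS : ∀ π ∈ S, HasLayers π (a π)) {D : ℝ}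
    (hD : ∀ w : Fin n → ℝ, (∀ t, 0 ≤ w t) → ∑ t, w t = 1 →
      ∑ π ∈ S, (Nat.multinomial Finset.univ (a π) : ℝ) * chainSum (a π) w ≤ D)
    (σ : Fin n → Fin k) :
    (numOccurrences (patternsOf S) σ : ℝ) * m.factorial ≤ D * n ^ m := by
  classical
  rcases Nat.eq_zero_or_pos n with rfl | hn
  · have : numOccurrences (patternsOf S) σ = 0 := by
      have := numOccurrences_le_choose (patternsOf S) σ
      rw [Nat.choose_eq_zero_of_lt hm] at this
      omega
    simp [this, hm.ne']
  have hn0 : (0 : ℝ) < n := by exact_mod_cast hn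
  set R : Fin n → Fin n → Prop := fun i j => i < j ∧ σ i < σ j with hR
  have hup := sum_tupleProb_le (m := m) (R := R) (fun i j h => h.1) S a
    (fun π hπ => (hS π hπ).pos) hD (fun _ => (n : ℝ)⁻¹) (fun _ => by positivity)
    (by simp [hn0.ne'])
  set A : Finset (Fin m ↪o Fin n) :=
    Finset.univ.filter fun f => ∃ p ∈ patternsOf S, IsOccurrence p σ f with hA
  have hcard : numOccurrences (patternsOf S) σ = A.card := by
    rw [numOccurrences, ← Set.ncard_coe_finset]
    congr 1
    ext f
    simp [hA]
  have hsum : ∑ π ∈ S, tupleProb m R (a π) (fun _ => (n : ℝ)⁻¹) =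
      (∑ z : Fin m → Fin n, ∑ π ∈ S, if IsLayeredTuple R (a π) z then (1 : ℝ) else 0) / n ^ m := by
    simp only [tupleProb, Finset.prod_const, Finset.card_univ, Fintype.card_fin]
    rw [Finset.sum_comm, Finset.sum_div]
    refine Finset.sum_congr rfl fun z _ => ?_
    rw [← Finset.sum_mul, inv_pow, div_eq_mul_inv]
  rw [hsum, div_le_iff₀ (by positivity)] at hup
  refine le_trans ?_ hup
  have hcount : A.card * m.factorial =
      ((A ×ˢ (Finset.univ : Finset (Equiv.Perm (Fin m)))).image
        fun x (p : Fin m) => x.1 (x.2 p)).card := by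
    rw [Finset.card_image_of_injective _ (orderEmbedding_comp_perm_injective m n),
      Finset.card_product, Finset.card_univ, Fintype.card_perm, Fintype.card_fin]
  rw [hcard]
  have hcast : ((A.card * m.factorial : ℕ) : ℝ) = A.card * m.factorial := by push_cast; rfl
  rw [← hcast, hcount, Finset.card_eq_sum_ones, Nat.cast_sum]
  refine (Finset.sum_le_sum fun z hz => ?_).trans
    (Finset.sum_le_sum_of_subset_of_nonneg (Finset.subset_univ _) fun z _ _ =>
      Finset.sum_nonneg fun π _ => by split_ifs <;> simp)
  obtain ⟨⟨f, τ⟩, hx, rfl⟩ := Finset.mem_image.1 hz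
  obtain ⟨p, ⟨π, hπ, rfl⟩, hocc⟩ := (Finset.mem_filter.1 (Finset.mem_product.1 hx).1).2
  -- Listing the positions in the order `τ` only permutes the layer map `b`, without changing its
  -- fibre sizes.
  have hgood : IsLayeredTuple R (a π) fun p => f (τ p) := by
    obtain ⟨b, hb, -, hbπ, hab⟩ := hS π hπ
    refine ⟨fun p => b (τ p), fun i => ?_, fun p q => ?_⟩
    · rw [hab]
      refine Finset.card_bij (fun p _ => τ.symm p) ?_ ?_ ?_
      · intro p hp
        simpa using hp
      · intro p _ q _ h
        exact τ.symm.injective h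
      · intro p hp
        exact ⟨τ p, by simpa using hp, by simp⟩
    · rw [layer_lt_iff hb hbπ, hocc (τ p) (τ q), hR]
      simp
  refine le_of_eq_of_le ?_ (Finset.single_le_sum
    (f := fun π => if IsLayeredTuple R (a π) (fun p => f (τ p)) then (1 : ℝ) else 0)
    (fun π _ => by split_ifs <;> simp) hπ)
  simp [hgood]

/-! ### The lower bound: occurrences in layered words -/

/-- The sublevel sets of a monotone map are initial segments, and their sizes are partial sums of
the fibre sizes. A point with `c p < c' p` would make one such segment contain `p` and the other, of
equal size, stop before it. -/
theorem monotone_eq_of_card_fiber_eq {m r : ℕ} {b b' : Fin m → Fin r} (hb : Monotone b)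
    (hb' : Monotone b') (h : ∀ i, (Finset.univ.filter fun p => b p = i).card =
      (Finset.univ.filter fun p => b' p = i).card) : b = b' := by
  have hle : ∀ c : Fin m → Fin r, ∀ i, (Finset.univ.filter fun p => c p ≤ i).card =
      ∑ j ∈ Finset.Iic i, (Finset.univ.filter fun p => c p = j).card := by
    intro c i
    rw [Finset.sum_card_fiberwise_eq_card_filter]
    simp
  have key : ∀ c c' : Fin m → Fin r, Monotone c → Monotone c' →
      (∀ i, (Finset.univ.filter fun p => c p = i).card =
        (Finset.univ.filter fun p => c' p = i).card) → ∀ p, ¬ c p < c' p := by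
    intro c c' hc hc' hcc p hp
    have h1 : (Finset.univ.filter fun q => c q ≤ c p).card =
        (Finset.univ.filter fun q => c' q ≤ c p).card := by
      rw [hle, hle]
      exact Finset.sum_congr rfl fun j _ => hcc j
    have h2 : Finset.Iic p ⊆ Finset.univ.filter fun q => c q ≤ c p := fun q hq => by
      simpa using hc (Finset.mem_Iic.1 hq)
    have h3 : (Finset.univ.filter fun q => c' q ≤ c p) ⊆ Finset.Iio p := fun q hq => by
      rw [Finset.mem_Iio]
      by_contra hpq
      exact ((Finset.mem_filter.1 hq).2.trans_lt hp).not_ge (hc' (not_lt.1 hpq))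
    have h4 := Finset.card_le_card h2
    have h5 := Finset.card_le_card h3
    rw [Fin.card_Iic] at h4
    rw [Fin.card_Iio] at h5
    omega
  funext p
  exact le_antisymm (not_lt.1 (key b' b hb' hb (fun i => (h i).symm) p))
    (not_lt.1 (key b b' hb hb' h p))

/-- The identity is the only order automorphism of `Fin m`. Hence occurrences of distinct patterns
in a word are distinct. -/
theorem perm_eq_of_lt_iff {m : ℕ} {π π' : Equiv.Perm (Fin m)}
    (h : ∀ i j, π i < π j ↔ π' i < π' j) : π = π' := by
  let e' : Fin m ≃o Fin m := (StrictMono.orderIsoOfSurjective (fun i => π' (π.symm i))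
    (fun i j hij => by
      rw [← h]
      simpa using hij) (π'.surjective.comp π.symm.surjective))
  have h2 : e' = OrderIso.refl _ := Subsingleton.elim _ _
  ext i
  have h3 : π' (π.symm (π i)) = π i := DFunLike.congr_fun h2 (π i)
  rw [Equiv.symm_apply_apply] at h3
  rw [h3]

/-- The word whose positions are divided into blocks by `B`, the letters being decreasing inside a
block and increasing from one block to a later one. -/
def layeredWord {n r : ℕ} (B : Fin n → ℕ) (hB : ∀ p, B p ≤ r) (p : Fin n) : Fin ((r + 1) * n) :=
  ⟨B p * n + (n - 1 - p), by
    have h1 := Nat.mul_le_mul_right n (hB p)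
    have h2 := p.2
    rw [Nat.add_mul]
    omega⟩

theorem layeredWord_lt_iff {n r : ℕ} {B : Fin n → ℕ} (hB : ∀ p, B p ≤ r) {p q : Fin n} :
    layeredWord B hB p < layeredWord B hB q ↔ B p < B q ∨ (B p = B q ∧ q < p) := by
  have hp := p.2
  have hq := q.2
  rw [Fin.lt_def, Fin.lt_def]
  simp only [layeredWord]
  rcases lt_trichotomy (B p) (B q) with h | h | h
  · have := Nat.mul_le_mul_right n (Nat.succ_le_of_lt h)
    rw [Nat.succ_mul] at this
    omega
  · rw [h]
    omega
  · have := Nat.mul_le_mul_right n (Nat.succ_le_of_lt h)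
    rw [Nat.succ_mul] at this
    omega

/-- Any choice of `a i` positions in block `i`, for every `i`, is an occurrence once the positions
are sorted. -/
theorem prod_choose_le_card_occurrences {m r n : ℕ} {π : Equiv.Perm (Fin m)} {a : Fin r → ℕ}
    (hπ : HasLayers π a) {B : Fin n → ℕ} (hB : ∀ p, B p ≤ r) (hBm : Monotone B)
    (blk : Fin r → Finset (Fin n)) (hblk : ∀ i, ∀ p ∈ blk i, B p = i) :
    ∏ i, (blk i).card.choose (a i) ≤
      Set.ncard {f : Fin m ↪o Fin n | IsOccurrence (⇑π) (layeredWord B hB) f} := by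
  classical
  have hsum := hπ.sum_eq
  obtain ⟨b, hb, -, hbπ, hab⟩ := hπ
  have hcard : (Fintype.piFinset fun i => (blk i).powersetCard (a i)).card =
      ∏ i, (blk i).card.choose (a i) := by
    simp [Fintype.card_piFinset]
  rw [← hcard, ← Set.ncard_coe_finset]
  -- Intersecting with the blocks maps occurrences onto a set containing all such choices, so
  -- surjectivity suffices for the count.
  refine le_trans (Set.ncard_le_ncard (t := (fun (f : Fin m ↪o Fin n) (i : Fin r) =>
    Finset.univ.filter fun p => (∃ q, f q = p) ∧ p ∈ blk i) ''
      {f : Fin m ↪o Fin n | IsOccurrence (⇑π) (layeredWord B hB) f}) ?_) Set.ncard_image_le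
  intro T hT
  have hT' : ∀ i, T i ⊆ blk i ∧ (T i).card = a i := by
    simpa [Fintype.mem_piFinset, Finset.mem_powersetCard] using hT
  set U := Finset.univ.biUnion T with hU
  have hdisj : ∀ i j p, p ∈ T i → p ∈ blk j → i = j := fun i j p hi hj =>
    Fin.ext ((hblk i p ((hT' i).1 hi)).symm.trans (hblk j p hj))
  have hUcard : U.card = m := by
    rw [hU, Finset.card_biUnion, ← hsum]
    · exact Finset.sum_congr rfl fun i _ => (hT' i).2
    · intro i _ j _ hij
      exact Finset.disjoint_left.2 fun p hi hj => hij (hdisj i j p hi ((hT' j).1 hj))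
  set f := U.orderEmbOfFin hUcard with hf
  have hfU : ∀ p, ∃ i, f p ∈ T i := fun p => by
    obtain ⟨i, -, hi⟩ := Finset.mem_biUnion.1 (U.orderEmbOfFin_mem hUcard p)
    exact ⟨i, hi⟩
  have hrange : ∀ p ∈ U, ∃ q, f q = p := fun p hp => by
    have := U.range_orderEmbOfFin hUcard
    have hp' : p ∈ Set.range (U.orderEmbOfFin hUcard) := by rw [this]; exact hp
    exact hp'
  choose c hc using hfU
  have hBc : ∀ p, B (f p) = c p := fun p => hblk _ _ ((hT' _).1 (hc p))
  have hcm : Monotone c := fun p q h => by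
    rw [Fin.le_def, ← hBc, ← hBc]
    exact hBm (f.monotone h)
  have hcb : c = b := by
    refine monotone_eq_of_card_fiber_eq hcm hb fun i => ?_
    rw [← hab, ← (hT' i).2]
    refine Finset.card_bij (fun p _ => f p) ?_ ?_ ?_
    · intro p hp
      rw [← (Finset.mem_filter.1 hp).2]
      exact hc p
    · intro p _ q _ h
      exact f.injective h
    · intro p hp
      obtain ⟨q, rfl⟩ := hrange p (Finset.mem_biUnion.2 ⟨i, Finset.mem_univ _, hp⟩)
      refine ⟨q, ?_, rfl⟩
      simp only [Finset.mem_filter, Finset.mem_univ, true_and]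
      exact hdisj _ _ _ (hc q) ((hT' i).1 hp)
  refine ⟨f, fun p q => ?_, ?_⟩
  · rw [layeredWord_lt_iff, hBc, hBc, hcb, f.lt_iff_lt, ← Fin.lt_def, Fin.val_inj]
    rcases lt_trichotomy p q with h | rfl | h
    · have := layer_lt_iff hb hbπ p q
      simp [this, h, h.not_gt]
    · simp
    · have h1 := hbπ q p h
      have h2 := hb h.le
      rw [h1]
      simp only [h, and_true, eq_comm (a := b q)]
      exact ⟨fun h => Or.inr h, fun h' => h'.resolve_left h2.not_gt⟩
  · funext i
    ext p
    simp only [Finset.mem_filter, Finset.mem_univ, true_and]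
    constructor
    · rintro ⟨⟨q, rfl⟩, hq⟩
      rw [← hdisj _ _ _ (hc q) hq]
      exact hc q
    · intro hp
      exact ⟨hrange p (Finset.mem_biUnion.2 ⟨i, Finset.mem_univ _, hp⟩), (hT' i).1 hp⟩

theorem sum_prod_choose_le_maxOccurrences {m r n : ℕ} (S : Finset (Equiv.Perm (Fin m)))
    (a : Equiv.Perm (Fin m) → Fin r → ℕ) (hS : ∀ π ∈ S, HasLayers π (a π)) (c : Fin r → ℕ)
    (hc : ∑ i, c i ≤ n) :
    ∑ π ∈ S, ∏ i, (c i).choose (a π i) ≤ maxOccurrences (patternsOf S) ((r + 1) * n) n := by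
  classical
  set t : ℕ → ℕ := fun i => ∑ j ∈ Finset.univ.filter (fun j : Fin r => (j : ℕ) < i), c j with ht
  have htm : Monotone t := fun i j hij => by
    refine Finset.sum_le_sum_of_subset fun x hx => ?_
    simp only [Finset.mem_filter, Finset.mem_univ, true_and] at hx ⊢
    omega
  have htn : ∀ i, t i ≤ n := fun i =>
    (Finset.sum_le_sum_of_subset (Finset.subset_univ _)).trans hc
  have htsucc : ∀ i : Fin r, t (i + 1) = t i + c i := by
    intro i
    have : Finset.univ.filter (fun j : Fin r => (j : ℕ) < i + 1) =
        insert i (Finset.univ.filter (fun j : Fin r => (j : ℕ) < i)) := by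
      ext j
      simp only [Finset.mem_filter, Finset.mem_univ, true_and, Finset.mem_insert, Fin.ext_iff]
      omega
    simp only [ht]
    rw [this, Finset.sum_insert (by simp), add_comm]
  -- The block index is the number of block ends at or before `p`. Positions beyond the last block
  -- get index `r` and lie in no `blk i`, so the `c i` need not fill the word.
  set B : Fin n → ℕ := fun p => ((Finset.range r).filter fun j => t (j + 1) ≤ p).card with hBdef
  have hB : ∀ p, B p ≤ r := fun p =>
    (Finset.card_filter_le _ _).trans (Finset.card_range r).le
  have hBm : Monotone B := fun p q hpq => by
    refine Finset.card_le_card fun j hj => ?_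
    simp only [Finset.mem_filter] at hj ⊢
    exact ⟨hj.1, hj.2.trans hpq⟩
  set blk : Fin r → Finset (Fin n) := fun i =>
    Finset.univ.filter fun p => t i ≤ p ∧ (p : ℕ) < t (i + 1) with hblkdef
  have hblk : ∀ i, ∀ p ∈ blk i, B p = i := by
    intro i p hp
    obtain ⟨h1, h2⟩ := (Finset.mem_filter.1 hp).2
    have : (Finset.range r).filter (fun j => t (j + 1) ≤ p) = Finset.range i := by
      ext j
      simp only [Finset.mem_filter, Finset.mem_range]
      constructor
      · rintro ⟨-, h3⟩
        by_contra h
        exact absurd (htm (show (i : ℕ) + 1 ≤ j + 1 by omega)) (by omega)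
      · intro h
        exact ⟨h.trans i.2, (htm (Nat.succ_le_of_lt h)).trans h1⟩
    simp only [hBdef]
    rw [this, Finset.card_range]
  have hblkcard : ∀ i, (blk i).card = c i := by
    intro i
    have : c i = (Finset.Ico (t i) (t (i + 1))).card := by
      rw [Nat.card_Ico, htsucc]
      omega
    rw [this]
    refine Finset.card_bij (fun p _ => (p : ℕ)) ?_ ?_ ?_
    · intro p hp
      simpa [hblkdef] using hp
    · intro p _ q _ h
      exact Fin.ext h
    · intro p hp
      obtain ⟨h1, h2⟩ := Finset.mem_Ico.1 hp
      exact ⟨⟨p, h2.trans_le (htn _)⟩, by simp [hblkdef, h1, h2], rfl⟩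
  refine le_trans ?_ (numOccurrences_le_maxOccurrences (patternsOf S) (layeredWord B hB))
  set A : Equiv.Perm (Fin m) → Finset (Fin m ↪o Fin n) := fun π =>
    Finset.univ.filter fun f => IsOccurrence (⇑π) (layeredWord B hB) f with hA
  have hAcard : ∀ π, (A π).card =
      Set.ncard {f : Fin m ↪o Fin n | IsOccurrence (⇑π) (layeredWord B hB) f} := fun π => by
    rw [← Set.ncard_coe_finset]
    congr 1
    ext f
    simp [hA]
  calc ∑ π ∈ S, ∏ i, (c i).choose (a π i) ≤ ∑ π ∈ S, (A π).card := by
        refine Finset.sum_le_sum fun π hπ => ?_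
        rw [hAcard]
        simpa only [hblkcard] using
          prod_choose_le_card_occurrences (hS π hπ) hB hBm blk hblk
    _ = (S.biUnion A).card := by
        rw [Finset.card_biUnion]
        intro π _ π' _ hne
        refine Finset.disjoint_left.2 fun f h1 h2 => hne (perm_eq_of_lt_iff fun i j => ?_)
        rw [(Finset.mem_filter.1 h1).2 i j, (Finset.mem_filter.1 h2).2 i j]
    _ = _ := by
        rw [numOccurrences, ← Set.ncard_coe_finset]
        congr 1
        ext f
        simp only [Finset.coe_biUnion, Set.mem_iUnion, patternsOf, hA]
        constructor
        · rintro ⟨π, hπ, hf⟩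
          exact ⟨_, ⟨π, hπ, rfl⟩, by simpa using hf⟩
        · rintro ⟨_, ⟨π, hπ, rfl⟩, hf⟩
          exact ⟨π, hπ, by simpa using hf⟩

/-- The falling factorial has `a` factors, each asymptotic to `x * n`; truncated subtraction does
not affect the limit. -/
theorem tendsto_choose_floor_div_pow {x : ℝ} (hx : 0 ≤ x) (a : ℕ) :
    Tendsto (fun n : ℕ => ((⌊x * n⌋₊.choose a : ℕ) : ℝ) / (n : ℝ) ^ a) atTop
      (𝓝 (x ^ a / a.factorial)) := by
  have hsub : ∀ i : ℕ, Tendsto (fun n : ℕ => ((⌊x * n⌋₊ - i : ℕ) : ℝ) / n) atTop (𝓝 x) := by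
    intro i
    have hfl := (tendsto_nat_floor_mul_div_atTop hx).comp (tendsto_natCast_atTop_atTop (R := ℝ))
    have hz : Tendsto (fun n : ℕ => (i : ℝ) / n) atTop (𝓝 0) :=
      tendsto_const_div_atTop_nhds_zero_nat (i : ℝ)
    refine tendsto_of_tendsto_of_tendsto_of_le_of_le (by simpa using hfl.sub hz) hfl
      (fun n => ?_) (fun n => ?_)
    · rw [← sub_div]
      gcongr
      rw [sub_le_iff_le_add]
      rw [← Nat.cast_add, Nat.cast_le]
      exact le_tsub_add
    · simp only [Function.comp_apply]
      gcongr
      omega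
  have hdesc : Tendsto (fun n : ℕ => ((⌊x * n⌋₊.descFactorial a : ℕ) : ℝ) / (n : ℝ) ^ a) atTop
      (𝓝 (x ^ a)) := by
    induction a with
    | zero => simp
    | succ a ih =>
      have := (hsub a).mul ih
      rw [← pow_succ'] at this
      refine this.congr fun n => ?_
      rw [Nat.descFactorial_succ, Nat.cast_mul, pow_succ', mul_div_mul_comm]
  refine (hdesc.div_const (a.factorial : ℝ)).congr fun n => ?_
  rw [Nat.descFactorial_eq_factorial_mul_choose, Nat.cast_mul]
  have : (a.factorial : ℝ) ≠ 0 := by exact_mod_cast a.factorial_ne_zero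
  field_simp

theorem tendsto_prod_choose_floor {m r : ℕ} (a : Fin r → ℕ) (ha : ∑ i, a i = m) {μ : Fin r → ℝ}
    (hμ : ∀ i, 0 ≤ μ i) :
    Tendsto (fun n : ℕ => ((∏ i, ⌊μ i * n⌋₊.choose (a i) : ℕ) : ℝ) * m.factorial / (n : ℝ) ^ m)
      atTop (𝓝 ((Nat.multinomial Finset.univ a : ℝ) * ∏ i, μ i ^ a i)) := by
  have h := (tendsto_finsetProd Finset.univ fun i _ =>
    tendsto_choose_floor_div_pow (hμ i) (a i)).mul_const (m.factorial : ℝ)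
  have hspec : ((∏ i, (a i).factorial : ℕ) : ℝ) * (Nat.multinomial Finset.univ a : ℝ) =
      (m.factorial : ℝ) := by
    rw [← Nat.cast_mul, Nat.multinomial_spec, ha]
  have hne : ((∏ i, (a i).factorial : ℕ) : ℝ) ≠ 0 := by
    exact_mod_cast Finset.prod_ne_zero_iff.2 fun i _ => (a i).factorial_ne_zero
  have e : (∏ i, μ i ^ a i / ((a i).factorial : ℝ)) * (m.factorial : ℝ) =
      (Nat.multinomial Finset.univ a : ℝ) * ∏ i, μ i ^ a i := by
    rw [← hspec, Finset.prod_div_distrib, ← Nat.cast_prod]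
    field_simp
  rw [e] at h
  refine h.congr fun n => ?_
  rw [Finset.prod_div_distrib, Finset.prod_pow_eq_pow_sum, ha, Nat.cast_prod]
  ring

/-- The packing density of a set of layered permutations, when the supremum over finite chains of
weights is attained with `r` weights. -/
theorem hasPackingDensity_of_chainSum_le {m r : ℕ} (hm : 0 < m) (S : Finset (Equiv.Perm (Fin m)))
    (a : Equiv.Perm (Fin m) → Fin r → ℕ) (hS : ∀ π ∈ S, HasLayers π (a π)) {μ : Fin r → ℝ}
    (hμ : ∀ i, 0 ≤ μ i) (hμ1 : ∑ i, μ i = 1)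
    (hD : ∀ n, ∀ w : Fin n → ℝ, (∀ t, 0 ≤ w t) → ∑ t, w t = 1 →
      ∑ π ∈ S, (Nat.multinomial Finset.univ (a π) : ℝ) * chainSum (a π) w ≤
        ∑ π ∈ S, (Nat.multinomial Finset.univ (a π) : ℝ) * ∏ i, μ i ^ a π i) :
    HasPackingDensity (patternsOf S)
      (∑ π ∈ S, (Nat.multinomial Finset.univ (a π) : ℝ) * ∏ i, μ i ^ a π i) := by
  set D := ∑ π ∈ S, (Nat.multinomial Finset.univ (a π) : ℝ) * ∏ i, μ i ^ a π i with hDdef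
  have hup : ∀ k n, (maxOccurrences (patternsOf S) k n : ℝ) * m.factorial ≤ D * n ^ m := by
    intro k n
    -- Over an empty alphabet there may be no word at all; the supremum is then 0 by default.
    rcases isEmpty_or_nonempty (Fin n → Fin k) with he | hne
    · have hzero : maxOccurrences (patternsOf S) k n = 0 := by
        simp [maxOccurrences, Finset.univ_eq_empty]
      have hD0 : 0 ≤ D := Finset.sum_nonneg fun π _ =>
        mul_nonneg (Nat.cast_nonneg _) (Finset.prod_nonneg fun i _ => pow_nonneg (hμ i) _)
      rw [hzero]
      simp only [Nat.cast_zero, zero_mul]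
      positivity
    · obtain ⟨σ, -, hσ⟩ := Finset.exists_mem_eq_sup Finset.univ Finset.univ_nonempty
        fun σ : Fin n → Fin k => numOccurrences (patternsOf S) σ
      rw [maxOccurrences, hσ]
      exact numOccurrences_mul_factorial_le hm S a hS (hD n) σ
  refine hasPackingDensity_of_bounds _ (fun n => (r + 1) * n) hup ?_
  have hlow : Tendsto (fun n : ℕ => ∑ π ∈ S,
      ((∏ i, ⌊μ i * n⌋₊.choose (a π i) : ℕ) : ℝ) * m.factorial / (n : ℝ) ^ m) atTop (𝓝 D) :=
    tendsto_finsetSum _ fun π hπ => tendsto_prod_choose_floor (a π) (hS π hπ).sum_eq hμ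
  refine tendsto_of_tendsto_of_tendsto_of_le_of_le' hlow tendsto_const_nhds ?_ ?_
  · refine Eventually.of_forall fun n => ?_
    rw [← Finset.sum_div, ← Finset.sum_mul]
    gcongr
    rw [← Nat.cast_sum, Nat.cast_le]
    refine sum_prod_choose_le_maxOccurrences S a hS _ ?_
    have : ((∑ i, ⌊μ i * n⌋₊ : ℕ) : ℝ) ≤ n := by
      rw [Nat.cast_sum]
      calc ∑ i, (⌊μ i * n⌋₊ : ℝ) ≤ ∑ i, μ i * n := Finset.sum_le_sum fun i _ =>
            Nat.floor_le (mul_nonneg (hμ i) (Nat.cast_nonneg n))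
        _ = n := by rw [← Finset.sum_mul, hμ1, one_mul]
    exact_mod_cast this
  · filter_upwards [eventually_gt_atTop 0] with n hn
    have hn0 : (0 : ℝ) < n := by exact_mod_cast hn
    rw [div_le_iff₀ (by positivity)]
    exact hup _ n

/-! ### Recursive evaluation of chain sums -/

theorem chainSum_zero {n : ℕ} (a : Fin 0 → ℕ) (w : Fin n → ℝ) : chainSum a w = 1 := by
  have : Fintype.card (Fin 0 ↪o Fin n) = 1 := by
    rw [← Nat.card_eq_fintype_card, card_orderEmbedding_fin, Nat.choose_zero_right]
  simp [chainSum, this]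

theorem chainSum_succ_zero {r : ℕ} (a : Fin (r + 1) → ℕ) (w : Fin 0 → ℝ) : chainSum a w = 0 := by
  have : Fintype.card (Fin (r + 1) ↪o Fin 0) = 0 := by
    rw [← Nat.card_eq_fintype_card, card_orderEmbedding_fin, Nat.choose_zero_succ]
  have := Fintype.card_eq_zero_iff.1 this
  simp [chainSum]

/-- Prepend the smallest element to an increasing tuple. -/
def consZeroEmb {r n : ℕ} (g : Fin r ↪o Fin n) : Fin (r + 1) ↪o Fin (n + 1) :=
  OrderEmbedding.ofStrictMono (Fin.cons 0 fun i => (g i).succ) (by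
    intro i j hij
    induction j using Fin.cases with
    | zero => exact absurd hij (Fin.not_lt_zero i)
    | succ j =>
      induction i using Fin.cases with
      | zero => simp
      | succ i => simpa using hij)

theorem consZeroEmb_zero {r n : ℕ} (g : Fin r ↪o Fin n) : consZeroEmb g 0 = 0 := rfl

theorem consZeroEmb_succ {r n : ℕ} (g : Fin r ↪o Fin n) (i : Fin r) :
    consZeroEmb g i.succ = (g i).succ := rfl

/-- Chains split according to whether they start at the index 0. -/
theorem chainSum_succ_succ {r n : ℕ} (a : Fin (r + 1) → ℕ) (w : Fin (n + 1) → ℝ) :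
    chainSum a w = w 0 ^ a 0 * chainSum (fun i => a i.succ) (fun i => w i.succ) +
      chainSum a (fun i => w i.succ) := by
  classical
  rw [chainSum, ← Finset.sum_filter_add_sum_filter_not Finset.univ
    fun f : Fin (r + 1) ↪o Fin (n + 1) => f 0 = 0]
  congr 1
  · rw [chainSum, Finset.mul_sum]
    symm
    refine Finset.sum_bij (fun g _ => consZeroEmb g) ?_ ?_ ?_ ?_
    · intro g _
      simp [consZeroEmb_zero]
    · intro g _ g' _ h
      ext i
      have := DFunLike.congr_fun h i.succ
      simp only [consZeroEmb_succ] at this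
      rw [Fin.succ_injective _ this]
    · intro f hf
      have hf0 : f 0 = 0 := (Finset.mem_filter.1 hf).2
      have hne : ∀ i : Fin r, f i.succ ≠ 0 := fun i h =>
        Fin.succ_ne_zero i (f.injective (h.trans hf0.symm))
      refine ⟨OrderEmbedding.ofStrictMono (fun i => (f i.succ).pred (hne i)) ?_,
        Finset.mem_univ _, ?_⟩
      · intro i j hij
        simpa [Fin.pred_lt_pred_iff] using hij
      · refine DFunLike.ext _ _ fun i => ?_
        induction i using Fin.cases with
        | zero => rw [consZeroEmb_zero, hf0]
        | succ i => exact Fin.succ_pred _ (hne i)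
    · intro g _
      rw [Fin.prod_univ_succ]
      simp only [consZeroEmb_zero, consZeroEmb_succ]
  · symm
    refine Finset.sum_bij (fun g _ => g.trans (Fin.succOrderEmb n)) ?_ ?_ ?_ ?_
    · intro g _
      simp
    · intro g _ g' _ h
      ext i
      have := DFunLike.congr_fun h i
      simp only [RelEmbedding.coe_trans, Function.comp_apply, Fin.coe_succOrderEmb] at this
      rw [Fin.succ_injective _ this]
    · intro f hf
      have hf0 : f 0 ≠ 0 := (Finset.mem_filter.1 hf).2
      have hne : ∀ i, f i ≠ 0 := fun i h => hf0 (le_antisymm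
        ((f.monotone (Fin.zero_le i)).trans h.le) (Fin.zero_le _))
      refine ⟨OrderEmbedding.ofStrictMono (fun i => (f i).pred (hne i)) ?_,
        Finset.mem_univ _, ?_⟩
      · intro i j hij
        simpa [Fin.pred_lt_pred_iff] using hij
      · exact DFunLike.ext _ _ fun i => Fin.succ_pred _ (hne i)
    · intro g _
      simp

/-- The sum of `x_{i₁}^{a₁} ⋯ x_{i_r}^{a_r}` over `i₁ < ⋯ < i_r`, as a recursion on lists. -/
noncomputable def listChainSum : List ℕ → List ℝ → ℝ
  | [], _ => 1
  | _ :: _, [] => 0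
  | a :: as, x :: xs => x ^ a * listChainSum as xs + listChainSum (a :: as) xs

theorem listChainSum_nil (xs : List ℝ) : listChainSum [] xs = 1 := by
  cases xs <;> rfl

theorem listChainSum_cons_nil (a : ℕ) (as : List ℕ) : listChainSum (a :: as) [] = 0 := rfl

theorem listChainSum_cons_cons (a : ℕ) (as : List ℕ) (x : ℝ) (xs : List ℝ) :
    listChainSum (a :: as) (x :: xs) =
      x ^ a * listChainSum as xs + listChainSum (a :: as) xs := rfl

theorem chainSum_eq_listChainSum {r n : ℕ} (a : Fin r → ℕ) (w : Fin n → ℝ) :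
    chainSum a w = listChainSum (List.ofFn a) (List.ofFn w) := by
  induction n generalizing r with
  | zero =>
    cases r with
    | zero => rw [chainSum_zero, List.ofFn_zero, listChainSum_nil]
    | succ r => rw [chainSum_succ_zero, List.ofFn_succ, List.ofFn_zero, listChainSum_cons_nil]
  | succ n ih =>
    cases r with
    | zero => rw [chainSum_zero, List.ofFn_zero, listChainSum_nil]
    | succ r =>
      rw [chainSum_succ_succ, ih, ih, List.ofFn_succ (f := w), List.ofFn_succ (f := a),
        listChainSum_cons_cons]

theorem listChainSum_nonneg (as : List ℕ) {xs : List ℝ} (h : ∀ x ∈ xs, 0 ≤ x) :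
    0 ≤ listChainSum as xs := by
  induction xs generalizing as with
  | nil => cases as <;> simp [listChainSum_nil, listChainSum_cons_nil]
  | cons x xs ih =>
    cases as with
    | nil => simp [listChainSum_nil]
    | cons a as =>
      have h' : ∀ y ∈ xs, 0 ≤ y := fun y hy => h y (List.mem_cons_of_mem _ hy)
      have hx : 0 ≤ x := h x List.mem_cons_self
      have := ih as h'
      have := ih (a :: as) h'
      rw [listChainSum_cons_cons]
      positivity

theorem listChainSum_pos {as : List ℕ} {xs : List ℝ} (hlen : as.length ≤ xs.length)
    (h : ∀ x ∈ xs, 0 < x) : 0 < listChainSum as xs := by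
  induction xs generalizing as with
  | nil =>
    cases as with
    | nil => simp [listChainSum_nil]
    | cons a as => simp at hlen
  | cons x xs ih =>
    cases as with
    | nil => simp [listChainSum_nil]
    | cons a as =>
      have h' : ∀ y ∈ xs, 0 < y := fun y hy => h y (List.mem_cons_of_mem _ hy)
      have hx : 0 < x := h x List.mem_cons_self
      have h1 := ih (as := as) (by simpa using hlen) h'
      have h2 := listChainSum_nonneg (a :: as) fun y hy => (h' y hy).le
      rw [listChainSum_cons_cons]
      positivity

theorem listChainSum_eq_zero {as : List ℕ} {xs : List ℝ} (hlen : xs.length < as.length) :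
    listChainSum as xs = 0 := by
  induction xs generalizing as with
  | nil =>
    cases as with
    | nil => simp at hlen
    | cons a as => rfl
  | cons x xs ih =>
    cases as with
    | nil => simp at hlen
    | cons a as =>
      rw [List.length_cons, List.length_cons] at hlen
      rw [listChainSum_cons_cons, ih (by omega), ih (by rw [List.length_cons]; omega)]
      simp

theorem listChainSum_filter_ne_zero {as : List ℕ} (has : ∀ a ∈ as, 0 < a) (xs : List ℝ) :
    listChainSum as (xs.filter fun x => x ≠ 0) = listChainSum as xs := by
  induction xs generalizing as with
  | nil => rfl
  | cons x xs ih =>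
    cases as with
    | nil => simp [listChainSum_nil]
    | cons a as =>
      have has' : ∀ b ∈ as, 0 < b := fun b hb => has b (List.mem_cons_of_mem _ hb)
      have ha := has a List.mem_cons_self
      by_cases hx : x = 0
      · rw [List.filter_cons_of_neg (by simpa using hx), ih has, listChainSum_cons_cons, hx,
          zero_pow ha.ne']
        simp
      · rw [List.filter_cons_of_pos (by simpa using hx), listChainSum_cons_cons, ih has', ih has,
          listChainSum_cons_cons]

/-! ### Merging the two smallest parts -/

/-- Count pairs of a chain of length l, the length of `as`, and a further element of `xs`. Each
l-chain has `xs.length - l` extensions and each (l+1)-chain arises l+1 times. Passing from the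
exponents `as` to `b :: as` shifts exponents to earlier elements, so as the list increases from `y`,
the long monomial is at least `y ^ b` times the short one. The induction below carries out this
count recursively. -/
theorem mul_listChainSum_le {y : ℝ} (hy : 0 ≤ y) (b : ℕ) (as : List ℕ) (xs : List ℝ)
    (hxs : (y :: xs).Pairwise (· ≤ ·)) :
    ((xs.length : ℝ) - as.length) * (y ^ b * listChainSum as xs) ≤
      (as.length + 1) * listChainSum (b :: as) xs := by
  induction xs generalizing y b as with
  | nil =>
    have : 0 ≤ listChainSum as [] := listChainSum_nonneg as (by simp)
    rw [listChainSum_cons_nil, mul_zero, List.length_nil, Nat.cast_zero, zero_sub, neg_mul]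
    exact neg_nonpos.2 (by positivity)
  | cons x t ih =>
    obtain ⟨hyx, hxt⟩ := List.pairwise_cons.1 hxs
    have hle : y ≤ x := hyx x List.mem_cons_self
    have hx : 0 ≤ x := hy.trans hle
    have ht : ∀ z ∈ t, 0 ≤ z := fun z hz => hx.trans ((List.pairwise_cons.1 hxt).1 z hz)
    have ht' : ∀ z ∈ x :: t, 0 ≤ z := by
      intro z hz
      rcases List.mem_cons.1 hz with rfl | hz
      · exact hx
      · exact ht z hz
    have hE : 0 ≤ listChainSum as (x :: t) := listChainSum_nonneg as ht'
    have hE' : 0 ≤ listChainSum (b :: as) (x :: t) := listChainSum_nonneg _ ht'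
    rcases le_or_gt (((x :: t).length : ℝ) - as.length) 0 with hneg | hpos
    · exact (mul_nonpos_of_nonpos_of_nonneg hneg (by positivity)).trans (by positivity)
    have hpow : y ^ b ≤ x ^ b := by gcongr
    have h1 := ih hx b as hxt
    rw [listChainSum_cons_cons]
    refine (mul_le_mul_of_nonneg_left (mul_le_mul_of_nonneg_right hpow hE) hpos.le).trans ?_
    rw [List.length_cons] at hpos ⊢
    push_cast at hpos ⊢
    have hxb : 0 ≤ x ^ b := by positivity
    cases as with
    | nil =>
      simp only [listChainSum_nil, List.length_nil, Nat.cast_zero] at h1 ⊢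
      linarith
    | cons c cs =>
      -- Chains of `as` through `x` are controlled by the same inequality with `as` split as `c ::
      -- cs`; those avoiding `x` are controlled by `h1`.
      have h2 := mul_le_mul_of_nonneg_left (ih hx c cs hxt) hxb
      rw [listChainSum_cons_cons]
      rw [List.length_cons] at h1 ⊢
      push_cast at h1 ⊢
      linarith

/-- In the binomial expansion every monomial other than `y ^ a` is at least `x ^ a`, and their
coefficients sum to `2 ^ a - 1`. -/
theorem pow_add_pow_le_add_pow {x y : ℝ} (hx : 0 ≤ x) (hxy : x ≤ y) (a : ℕ) :
    y ^ a + (2 ^ a - 1) * x ^ a ≤ (x + y) ^ a := by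
  have hy := hx.trans hxy
  induction a with
  | zero => simp
  | succ a ih =>
    have h2 : (1 : ℝ) ≤ 2 ^ a := one_le_pow₀ (by norm_num)
    have h3 : x ^ a ≤ y ^ a := by gcongr
    have h4 : 0 ≤ x * (y ^ a - x ^ a) := mul_nonneg hx (sub_nonneg.2 h3)
    have h5 : 0 ≤ (2 ^ a - 1) * x ^ a * (y - x) :=
      mul_nonneg (mul_nonneg (by linarith) (by positivity)) (by linarith)
    calc y ^ (a + 1) + (2 ^ (a + 1) - 1) * x ^ (a + 1)
        ≤ (x + y) * (y ^ a + (2 ^ a - 1) * x ^ a) := by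
          have : (x + y) * (y ^ a + (2 ^ a - 1) * x ^ a) -
            (y ^ (a + 1) + (2 ^ (a + 1) - 1) * x ^ (a + 1)) =
            x * (y ^ a - x ^ a) + (2 ^ a - 1) * x ^ a * (y - x) := by ring
          linarith
      _ ≤ (x + y) * (x + y) ^ a := mul_le_mul_of_nonneg_left ih (by linarith)
      _ = (x + y) ^ (a + 1) := by ring

/-- Merging the two smallest parts of an increasing list does not decrease the chain sum, and
the gain is quantified. -/
theorem listChainSum_merge {a b : ℕ} {as : List ℕ} {x y : ℝ} {xs : List ℝ} (hx : 0 ≤ x)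
    (hxs : (x :: y :: xs).Pairwise (· ≤ ·)) (ha : (as.length : ℝ) + 3 ≤ 2 ^ a) :
    listChainSum (a :: b :: as) (x :: y :: xs) +
        ((xs.length : ℝ) - as.length - 1) * (x ^ a * (y ^ b * listChainSum as xs)) ≤
      listChainSum (a :: b :: as) ((x + y) :: xs) := by
  obtain ⟨h1, hyxs⟩ := List.pairwise_cons.1 hxs
  have hxy : x ≤ y := h1 y List.mem_cons_self
  have hy := hx.trans hxy
  have hpos : ∀ z ∈ xs, 0 ≤ z := fun z hz => hy.trans ((List.pairwise_cons.1 hyxs).1 z hz)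
  have hE : 0 ≤ listChainSum (b :: as) xs := listChainSum_nonneg _ hpos
  have hxa : 0 ≤ x ^ a := by positivity
  -- `key` bounds the lost term, from chains using both `x` and `y`, while `hp` and `h2` bound the
  -- gain: `2 ^ a - 2 ≥ as.length + 1`.
  have key := mul_le_mul_of_nonneg_left (mul_listChainSum_le hy b as xs hyxs) hxa
  have hp := mul_le_mul_of_nonneg_right (pow_add_pow_le_add_pow hx hxy a) hE
  have h2 := mul_le_mul_of_nonneg_right ha (mul_nonneg hxa hE)
  simp only [listChainSum_cons_cons]
  nlinarith

/-! ### Partitions of unity with finitely many parts -/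

theorem partitionDensity_eq_sum_chainSum {m r : ℕ} (S : Finset (Equiv.Perm (Fin m)))
    (a : Equiv.Perm (Fin m) → Fin r → ℕ) (ha : ∀ π ∈ S, ∀ i, 0 < a π i) {lam : ℕ → ℝ} {n : ℕ}
    (hn : ∀ i, n ≤ i → lam i = 0) :
    partitionDensity S a lam =
      ∑ π ∈ S, (Nat.multinomial Finset.univ (a π) : ℝ) *
        chainSum (a π) fun i : Fin n => lam i := by
  refine Finset.sum_congr rfl fun π hπ => ?_
  congr 1
  have hinj : Function.Injective fun f : Fin r ↪o Fin n => f.trans (Fin.valOrderEmb n) := by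
    intro f g h
    ext i
    exact DFunLike.congr_fun h i
  rw [← hinj.tsum_eq, tsum_fintype]
  · rfl
  · intro f hf
    -- Positive exponents matter here: a zero part must kill its monomial, and `0 ^ 0 = 1`.
    have hlt : ∀ j, f j < n := fun j => by
      by_contra h
      refine hf (Finset.prod_eq_zero (Finset.mem_univ j) ?_)
      rw [hn _ (not_lt.1 h), zero_pow (ha π hπ j).ne']
    refine ⟨OrderEmbedding.ofStrictMono (fun j => ⟨f j, hlt j⟩) fun i j hij => ?_, ?_⟩
    · exact OrderEmbedding.strictMono f hij
    · ext j
      rfl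

/-- Extend a finite sequence by zeros. -/
noncomputable def extendZero {n : ℕ} (w : Fin n → ℝ) (i : ℕ) : ℝ :=
  if h : i < n then w ⟨i, h⟩ else 0

theorem extendZero_val {n : ℕ} (w : Fin n → ℝ) (i : Fin n) : extendZero w i = w i := by
  simp [extendZero]

theorem extendZero_of_le {n : ℕ} (w : Fin n → ℝ) {i : ℕ} (h : n ≤ i) : extendZero w i = 0 := by
  simp [extendZero, h]

theorem isPartitionOfUnity_extendZero {n : ℕ} {w : Fin n → ℝ} (hw : ∀ i, 0 ≤ w i)
    (h1 : ∑ i, w i = 1) : IsPartitionOfUnity (extendZero w) := by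
  refine ⟨fun i => ?_, ?_⟩
  · unfold extendZero
    split_ifs
    exacts [hw _, le_rfl]
  · have h : HasSum (extendZero w) (∑ i ∈ Finset.range n, extendZero w i) :=
      hasSum_sum_of_ne_finset_zero fun i hi => extendZero_of_le w (by simpa using hi)
    rw [← Fin.sum_univ_eq_sum_range] at h
    simpa only [extendZero_val, h1] using h

theorem partitionDensity_extendZero {m r n : ℕ} (S : Finset (Equiv.Perm (Fin m)))
    (a : Equiv.Perm (Fin m) → Fin r → ℕ) (ha : ∀ π ∈ S, ∀ i, 0 < a π i) (w : Fin n → ℝ) :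
    partitionDensity S a (extendZero w) =
      ∑ π ∈ S, (Nat.multinomial Finset.univ (a π) : ℝ) * chainSum (a π) w := by
  rw [partitionDensity_eq_sum_chainSum S a ha (n := n) fun i hi => extendZero_of_le w hi]
  simp only [extendZero_val]

/-- Infinitely many increasing parts would all eventually be at least one fixed positive part,
contradicting summability. -/
theorem IsPartitionOfUnity.eventually_zero {lam : ℕ → ℝ} (h : IsPartitionOfUnity lam)
    (hmono : MonotoneOn lam (Function.support lam)) : ∃ n, ∀ i, n ≤ i → lam i = 0 := by
  by_contra! hinf
  obtain ⟨i₀, -, hi₀⟩ := hinf 0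
  have hpos : 0 < lam i₀ := (h.1 i₀).lt_of_ne' hi₀
  obtain ⟨N, hN⟩ := eventually_atTop.1
    (h.2.summable.tendsto_atTop_zero.eventually_lt_const hpos)
  obtain ⟨i, hi, hi0⟩ := hinf (max N i₀)
  exact (hN i ((le_max_left _ _).trans hi)).not_ge
    (hmono hi₀ hi0 ((le_max_right _ _).trans hi))

theorem List.sum_filter_ne_zero (xs : List ℝ) : (xs.filter fun x => x ≠ 0).sum = xs.sum := by
  induction xs with
  | nil => rfl
  | cons x xs ih =>
    by_cases hx : x = 0
    · rw [List.filter_cons_of_neg (by simpa using hx), ih, hx, List.sum_cons, zero_add]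
    · rw [List.filter_cons_of_pos (by simpa using hx), List.sum_cons, List.sum_cons, ih]

theorem listChainSum_singleton_le {a : ℕ} (ha : 0 < a) {xs : List ℝ} (h0 : ∀ x ∈ xs, 0 ≤ x)
    (h1 : xs.sum ≤ 1) : listChainSum [a] xs ≤ xs.sum := by
  induction xs with
  | nil => simp [listChainSum_cons_nil]
  | cons x xs ih =>
    have h0' : ∀ y ∈ xs, 0 ≤ y := fun y hy => h0 y (List.mem_cons_of_mem _ hy)
    have hx := h0 x List.mem_cons_self
    have hs : 0 ≤ xs.sum := List.sum_nonneg h0'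
    rw [List.sum_cons] at h1 ⊢
    rw [listChainSum_cons_cons, listChainSum_nil, mul_one]
    exact add_le_add (pow_le_of_le_one hx (by linarith) ha.ne') (ih h0' (by linarith))

theorem chainSum_self {r : ℕ} (a : Fin r → ℕ) (w : Fin r → ℝ) :
    chainSum a w = ∏ i, w i ^ a i := by
  have hcard : Fintype.card (Fin r ↪o Fin r) = 1 := by
    rw [← Nat.card_eq_fintype_card, card_orderEmbedding_fin, Nat.choose_self]
  have : Subsingleton (Fin r ↪o Fin r) := Fintype.card_le_one_iff_subsingleton.1 hcard.le
  rw [chainSum, Fintype.sum_subsingleton _ (RelEmbedding.refl _)]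
  rfl

section Simple

variable {m r : ℕ} (S : Finset (Equiv.Perm (Fin m))) (a : Equiv.Perm (Fin m) → Fin r → ℕ)

/-- The weighted chain sum of a list of parts. -/
noncomputable def listDensity (xs : List ℝ) : ℝ :=
  ∑ π ∈ S, (Nat.multinomial Finset.univ (a π) : ℝ) * listChainSum (List.ofFn (a π)) xs

theorem listDensity_ofFn {n : ℕ} (w : Fin n → ℝ) :
    listDensity S a (List.ofFn w) =
      ∑ π ∈ S, (Nat.multinomial Finset.univ (a π) : ℝ) * chainSum (a π) w := by
  simp only [listDensity, chainSum_eq_listChainSum]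

theorem multinomial_cast_pos (π : Equiv.Perm (Fin m)) :
    (0 : ℝ) < Nat.multinomial Finset.univ (a π) := by
  exact_mod_cast Nat.multinomial_pos _ _

theorem listDensity_pos (hS : S.Nonempty) {xs : List ℝ} (hlen : r ≤ xs.length)
    (h : ∀ x ∈ xs, 0 < x) : 0 < listDensity S a xs :=
  Finset.sum_pos (fun π _ => mul_pos (multinomial_cast_pos a π)
    (listChainSum_pos (by simpa using hlen) h)) hS

/-- An increasing list of parts of maximal density can be replaced by a list of `r` parts. -/
theorem exists_list_of_length_eq (hS : S.Nonempty) (hr : 0 < r)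
    (ha : ∀ π ∈ S, ∀ i, 0 < a π i) (hlog : ∀ π ∈ S, ∀ i, r + 1 ≤ 2 ^ a π i) {xs : List ℝ}
    (hpos : ∀ x ∈ xs, 0 < x) (hsum : xs.sum = 1) (hsort : xs.Pairwise (· ≤ ·))
    (hmax : ∀ ys : List ℝ, (∀ y ∈ ys, 0 ≤ y) → ys.sum = 1 →
      listDensity S a ys ≤ listDensity S a xs) :
    ∃ ys : List ℝ, ys.length = r ∧ (∀ y ∈ ys, 0 < y) ∧ ys.sum = 1 ∧
      listDensity S a ys = listDensity S a xs := by
  have hr0 : (0 : ℝ) < r := by exact_mod_cast hr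
  rcases lt_trichotomy xs.length r with hlt | heq | hgt
  -- Fewer than `r` parts give density 0, while `r` equal parts give a positive one.
  · have hzero : listDensity S a xs = 0 :=
      Finset.sum_eq_zero fun π _ => by rw [listChainSum_eq_zero (by simpa using hlt), mul_zero]
    have hu : ∀ y ∈ List.replicate r (r : ℝ)⁻¹, 0 < y := fun y hy => by
      rw [List.eq_of_mem_replicate hy]
      positivity
    have h1 := hmax (List.replicate r (r : ℝ)⁻¹) (fun y hy => (hu y hy).le)
      (by rw [List.sum_replicate, nsmul_eq_mul, mul_inv_cancel₀ hr0.ne'])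
    have h2 := listDensity_pos S a hS (xs := List.replicate r (r : ℝ)⁻¹) (by simp) hu
    exact absurd h2 (by rw [← hzero]; exact h1.not_gt)
  · exact ⟨xs, heq, hpos, hsum, rfl⟩
  obtain ⟨k, rfl⟩ : ∃ k, r = k + 1 := ⟨r - 1, by omega⟩
  rcases k with _ | k
  -- With one layer there is no second exponent and the merging lemma does not apply; the single
  -- part 1 is optimal because `∑ x ^ a ≤ ∑ x`.
  · refine ⟨[1], rfl, by simp, by simp, le_antisymm (hmax _ (by simp) (by simp)) ?_⟩
    refine Finset.sum_le_sum fun π hπ => mul_le_mul_of_nonneg_left ?_ (Nat.cast_nonneg _)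
    have hfn : List.ofFn (a π) = [a π 0] := by simp [List.ofFn_succ]
    rw [hfn]
    refine (listChainSum_singleton_le (ha π hπ 0) (fun x hx => (hpos x hx).le) hsum.le).trans ?_
    rw [hsum, listChainSum_cons_cons, listChainSum_nil, listChainSum_cons_nil]
    simp
  obtain ⟨x, y, zs, rfl⟩ : ∃ x y zs, xs = x :: y :: zs := by
    rcases xs with _ | ⟨x, _ | ⟨y, zs⟩⟩
    · simp at hgt
    · simp at hgt
    · exact ⟨x, y, zs, rfl⟩
  have hx : 0 < x := hpos x (by simp)
  have hy : 0 < y := hpos y (by simp)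
  have hzs : ∀ z ∈ zs, 0 < z := fun z hz => hpos z (by simp [hz])
  have hys : ∀ z ∈ (x + y) :: zs, 0 < z := fun z hz => by
    rcases List.mem_cons.1 hz with rfl | hz
    · exact add_pos hx hy
    · exact hzs z hz
  have hysum : ((x + y) :: zs).sum = 1 := by
    rw [← hsum]
    simp [add_assoc]
  have hle := hmax _ (fun z hz => (hys z hz).le) hysum
  set g : Equiv.Perm (Fin m) → ℝ := fun π => (Nat.multinomial Finset.univ (a π) : ℝ) *
    (x ^ a π 0 * (y ^ a π 1 * listChainSum (List.ofFn fun i : Fin k => a π i.succ.succ) zs))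
    with hg
  have hlen : k + 1 ≤ zs.length := by
    simp only [List.length_cons] at hgt
    omega
  have hgpos : ∀ π, 0 < g π := fun π => mul_pos (multinomial_cast_pos a π)
    (mul_pos (pow_pos hx _) (mul_pos (pow_pos hy _)
      (listChainSum_pos (by rw [List.length_ofFn]; omega) hzs)))
  have hmerge : listDensity S a (x :: y :: zs) + ((zs.length : ℝ) - k - 1) * ∑ π ∈ S, g π ≤
      listDensity S a ((x + y) :: zs) := by
    rw [listDensity, Finset.mul_sum, ← Finset.sum_add_distrib]
    refine Finset.sum_le_sum fun π hπ => ?_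
    have hfn : List.ofFn (a π) = a π 0 :: a π 1 :: List.ofFn fun i : Fin k => a π i.succ.succ := by
      rw [List.ofFn_succ, List.ofFn_succ]
      rfl
    have hpow : ((List.ofFn fun i : Fin k => a π i.succ.succ).length : ℝ) + 3 ≤ 2 ^ a π 0 := by
      rw [List.length_ofFn]
      exact_mod_cast hlog π hπ 0
    have := mul_le_mul_of_nonneg_left
      (listChainSum_merge (b := a π 1) hx.le hsort hpow) (multinomial_cast_pos a π).le
    rw [List.length_ofFn] at this
    rw [hfn]
    refine le_trans (le_of_eq ?_) this
    simp only [hg]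
    ring
  have hGpos : 0 < ∑ π ∈ S, g π := Finset.sum_pos (fun π _ => hgpos π) hS
  -- A positive coefficient would make the merged list strictly better than an optimal one.
  have hlen' : (zs.length : ℝ) - k - 1 ≤ 0 := by
    by_contra h
    nlinarith [mul_pos (not_le.1 h) hGpos]
  have hlen'' : zs.length = k + 1 := by
    refine le_antisymm ?_ hlen
    have : (zs.length : ℝ) ≤ ((k + 1 : ℕ) : ℝ) := by
      push_cast
      linarith
    exact_mod_cast this
  -- The coefficient is now 0, so merging loses nothing. One merge suffices, so the merged list need
  -- not be increasing.
  refine ⟨(x + y) :: zs, by simp [hlen''], hys, hysum, le_antisymm hle ?_⟩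
  rw [hlen''] at hmerge
  push_cast at hmerge
  linarith

end Simple

theorem mainTheorem6 (m r : ℕ) (S : Finset (Equiv.Perm (Fin m)))
    (a : Equiv.Perm (Fin m) → Fin r → ℕ)
    (hS : ∀ π ∈ S, HasLayers π (a π))
    (hinc : ∃ lam : ℕ → ℝ, IsOptimalPartition S a lam ∧ MonotoneOn lam (Function.support lam))
    (mmin : ℕ)
    (hmin : IsLeast {x : ℕ | ∃ π ∈ S, ∃ i, a π i = x} mmin)
    (hlog : Real.logb 2 ((r : ℝ) + 1) ≤ (mmin : ℝ)) :
    IsSimpleSet S a ∧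
      ∃ d : ℝ, HasPackingDensity (patternsOf S) d ∧
        IsLUB {y : ℝ | ∃ lam ∈ stdSimplex ℝ (Fin r),
          y = ∑ π ∈ S, (Nat.multinomial Finset.univ (a π) : ℝ) * ∏ i, lam i ^ a π i} d := by
  obtain ⟨lam, hopt, hmono⟩ := hinc
  -- The witness of the minimum supplies both a member of `S` and a layer, hence `0 < r`.
  obtain ⟨π₀, hπ₀, i₀, -⟩ := hmin.1
  have hr : 0 < r := i₀.pos
  have hpos : ∀ π ∈ S, ∀ i, 0 < a π i := fun π hπ => (hS π hπ).pos
  have hm : 0 < m := by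
    rw [← (hS π₀ hπ₀).sum_eq]
    exact Finset.sum_pos (fun i _ => hpos π₀ hπ₀ i) ⟨i₀, Finset.mem_univ _⟩
  have hlog' : ∀ π ∈ S, ∀ i, r + 1 ≤ 2 ^ a π i := by
    intro π hπ i
    rw [Real.logb_le_iff_le_rpow (by norm_num) (by positivity), Real.rpow_natCast] at hlog
    have h1 : r + 1 ≤ 2 ^ mmin := by exact_mod_cast hlog
    exact h1.trans (Nat.pow_le_pow_right (by norm_num) (hmin.2 ⟨π, hπ, i, rfl⟩))
  obtain ⟨n, hn⟩ := hopt.1.eventually_zero hmono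
  -- Discarding the zeros leaves a globally increasing list, since monotonicity is assumed only on
  -- the support.
  set xs := (List.ofFn fun i : Fin n => lam i).filter fun x => x ≠ 0 with hxs
  have hdens : partitionDensity S a lam = listDensity S a xs := by
    rw [partitionDensity_eq_sum_chainSum S a hpos hn, ← listDensity_ofFn]
    refine Finset.sum_congr rfl fun π hπ => ?_
    rw [hxs, listChainSum_filter_ne_zero]
    intro c hc
    obtain ⟨i, rfl⟩ := (List.mem_ofFn' _ _).1 hc
    exact hpos π hπ i
  have hfin : ∀ k, ∀ w : Fin k → ℝ, (∀ t, 0 ≤ w t) → ∑ t, w t = 1 →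
      ∑ π ∈ S, (Nat.multinomial Finset.univ (a π) : ℝ) * chainSum (a π) w ≤
        listDensity S a xs := by
    intro k w hw hw1
    rw [← hdens, ← partitionDensity_extendZero S a hpos]
    exact hopt.2 _ (isPartitionOfUnity_extendZero hw hw1)
  have hxpos : ∀ x ∈ xs, 0 < x := by
    intro x hx
    obtain ⟨h1, h2⟩ := List.mem_filter.1 hx
    obtain ⟨i, rfl⟩ := (List.mem_ofFn' _ _).1 h1
    exact (hopt.1.1 i).lt_of_ne' (by simpa using h2)
  have hxsum : xs.sum = 1 := by
    rw [hxs, List.sum_filter_ne_zero, List.sum_ofFn, Fin.sum_univ_eq_sum_range]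
    exact (hasSum_sum_of_ne_finset_zero fun i hi => hn i (by simpa using hi)).unique hopt.1.2
  have hxsort : xs.Pairwise (· ≤ ·) := by
    rw [hxs, List.pairwise_filter, List.pairwise_ofFn]
    intro i j hij hi hj
    exact hmono (by simpa using hi) (by simpa using hj) hij.le
  have hmax : ∀ ys : List ℝ, (∀ y ∈ ys, 0 ≤ y) → ys.sum = 1 →
      listDensity S a ys ≤ listDensity S a xs := by
    intro ys hy hy1
    rw [← List.ofFn_get ys, listDensity_ofFn]
    refine hfin _ _ (fun t => hy _ (List.get_mem ys t)) ?_
    rw [← List.sum_ofFn, List.ofFn_get, hy1]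
  obtain ⟨ys, hlen, hypos, hysum, hyd⟩ :=
    exists_list_of_length_eq S a ⟨π₀, hπ₀⟩ hr hpos hlog' hxpos hxsum hxsort hmax
  subst hlen
  set μ : Fin ys.length → ℝ := ys.get with hμ
  have hμpos : ∀ i, 0 < μ i := fun i => hypos _ (List.get_mem ys i)
  have hμsum : ∑ i, μ i = 1 := by
    rw [← hysum, ← List.sum_ofFn, hμ, List.ofFn_get]
  have hD : ∑ π ∈ S, (Nat.multinomial Finset.univ (a π) : ℝ) * ∏ i, μ i ^ a π i =
      listDensity S a xs := by
    have h := listDensity_ofFn S a ys.get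
    rw [List.ofFn_get, hyd] at h
    simpa only [chainSum_self] using h.symm
  refine ⟨⟨extendZero μ, ⟨isPartitionOfUnity_extendZero (fun i => (hμpos i).le) hμsum, ?_⟩, ?_⟩,
    _, hasPackingDensity_of_chainSum_le hm S a hS (fun i => (hμpos i).le) hμsum
      (by rw [hD]; exact hfin), IsGreatest.isLUB ⟨?_, ?_⟩⟩
  · intro lam' hlam'
    rw [partitionDensity_extendZero S a hpos]
    simp only [chainSum_self]
    rw [hD, ← hdens]
    exact hopt.2 _ hlam'
  · have : Function.support (extendZero μ) = (Finset.range ys.length : Set ℕ) := by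
      ext i
      simp only [Function.mem_support, Finset.coe_range, Set.mem_Iio]
      constructor
      · intro h
        by_contra h'
        exact h (extendZero_of_le μ (not_lt.1 h'))
      · intro h
        rw [show i = ((⟨i, h⟩ : Fin ys.length) : ℕ) from rfl, extendZero_val]
        exact (hμpos _).ne'
    rw [this, Set.encard_coe_eq_coe_finsetCard, Finset.card_range]
  · exact ⟨μ, ⟨fun i => (hμpos i).le, hμsum⟩, rfl⟩
  · rintro _ ⟨w, ⟨hw0, hw1⟩, rfl⟩
    rw [hD]
    simpa only [chainSum_self] using hfin _ w hw0 hw1
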